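/- A continuum is a compact, connected, metrizable space; it carries its unique compatible uniformity. A cover of a continuum $X$ by a continuum is a regular covering map $f_i:X_i\to X=X_i/G_i$ with $X_i$ a continuum, i.e. a covering map that is also the quotient map of a free action of a group $G_i$ of homeomorphisms of $X_i$. Fix a base point of $X$ and base points of the $X_i$ lying over it. The covers of $X$ by continua form an inverse system, in which the bonding maps are the base-point preserving continuous onto maps $f_{ij}:X_j\to X_i$ with $f_j=f_i\circ f_{ij}$, and the groups are connected by the homomorphisms $\theta_{ij}:G_j\to G_i$ with $\theta_{ij}(g)\circ f_{ij}=f_{ij}\circ g$. Let $\widehat X=\varprojlim X_i$ be the compact universal cover of $X$, let $\widehat\phi:\widehat X\to X$ be the projection, and let $\pi_P(X)=\varprojlim G_i$ be the profinite fundamental group, which acts coordinatewise on $\widehat X$. A continuum $Z$ is called compactly simply connected if $\pi_P(Z)=1$. For a group $G$ of bijections of a uniform space $Y$ and an entourage $E$, let $N_E(G)$ be the subgroup generated by all $g\in G$ with $(x,g(x))\in E$ for some $x\in Y$. A map $f:Y\to X$ of uniform spaces is a generalized regular covering map with deck group $G$ if $Y$ has a basis of $G$-invariant entourages; for every entourage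 $E$ there is an entourage $F$ such that $(x,g(x))\in E$ for all $g\in N_F(G)$ and $x\in Y$; $G$ is complete in the uniformity of uniform convergence; and $f$ is the quotient map $Y\to X=Y/G$, where $X$ has the quotient uniformity. **Theorem (Uniqueness).** Let $X$ be a continuum. Then $\widehat X$ is a compactly simply connected continuum. Moreover, if $Y$ is a compactly simply connected continuum and $f:Y\to X=Y/G$ is a generalized regular covering map, then $f$ is equivalent to $\widehat\phi$: there are a (uniform) homeomorphism $h:Y\to\widehat X$ and a group isomorphism $\theta:G\to\pi_P(X)$ such that $h\circ g=\theta(g)\circ h$ for all $g\in G$ and $\widehat\phi\circ h=f$. -/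

import Mathlib

open Set Topology Uniformity

universe u v

/-- A continuum: a compact, connected (in particular nonempty), metrizable space. -/
class IsContinuum (X : Type u) [TopologicalSpace X] : Prop extends
  CompactSpace X, ConnectedSpace X, TopologicalSpace.MetrizableSpace X

/-! ### Regular covering maps and pointed covers by continua -/

/-- `f : Y → X` is a (traditional) regular covering map with group `G`: it is a covering map and
it is the quotient map of a free action of the group `G` of homeomorphisms of `Y`.
(As `G` is closed under inverses, continuity of its elements makes them homeomorphisms.) -/
structure IsRegularCovering {Y : Type u} {X : Type v} [TopologicalSpace Y] [TopologicalSpace X]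
    (f : Y → X) (G : Subgroup (Equiv.Perm Y)) : Prop where
  isCoveringMap : IsCoveringMap f
  isQuotientMap : IsQuotientMap f
  continuous_of_mem : ∀ g ∈ G, Continuous g
  free : ∀ g ∈ G, ∀ y, g y = y → g = 1
  fiber_eq_orbit : ∀ y z, f y = f z ↔ ∃ g ∈ G, g y = z

/-- A pointed cover of `(X, x₀)` by a continuum: a continuum with base point, together with a
base-point preserving regular covering map `proj` onto `X`, with group `deck`. -/
structure PointedCover (X : Type u) [TopologicalSpace X] (x₀ : X) where
  carrier : Type u
  [topology : TopologicalSpace carrier]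
  continuum : IsContinuum carrier
  proj : carrier → X
  deck : Subgroup (Equiv.Perm carrier)
  regular : IsRegularCovering proj deck
  base : carrier
  proj_base : proj base = x₀

namespace PointedCover

variable {X : Type u} [TopologicalSpace X] {x₀ : X}

instance (c : PointedCover X x₀) : TopologicalSpace c.carrier := c.topology

instance (c : PointedCover X x₀) : IsContinuum c.carrier := c.continuum

/-- `h` is a bonding map from the cover `c` to the cover `d`: a continuous onto map over `X`
that preserves base points. (There is at most one such map, since `c` is connected.) -/
structure IsBonding (c d : PointedCover X x₀) (h : c.carrier → d.carrier) : Prop where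
  continuous : Continuous h
  surjective : Function.Surjective h
  proj_comp : ∀ y, d.proj (h y) = c.proj y
  map_base : h c.base = d.base

/-- The trivial cover of `X` by itself. -/
def trivialCover (X : Type u) [TopologicalSpace X] [IsContinuum X] (x₀ : X) : PointedCover X x₀ where
  carrier := X
  continuum := inferInstance
  proj := id
  deck := ⊥
  regular :=
    { isCoveringMap := isLocalHomeomorph_iff_isCoveringMap.1 IsOpenEmbedding.id.isLocalHomeomorph
      isQuotientMap := IsQuotientMap.id
      continuous_of_mem := by
        intro g hg
        rw [Subgroup.mem_bot.1 hg]
        exact continuous_id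
      free := fun g hg _ _ => Subgroup.mem_bot.1 hg
      fiber_eq_orbit := by
        intro y z
        simp [Subgroup.mem_bot] }
  base := x₀
  proj_base := rfl

end PointedCover

/-! ### The compact universal cover and the profinite fundamental group -/

section UniversalCover

variable (X : Type u) [TopologicalSpace X] (x₀ : X)

/-- The compact universal cover of `X`: the inverse limit of all covers of `X` by continua along
the bonding maps, with the topology induced from the product. Equivalent covers (in particular
the same cover with two base points over `x₀`) are linked by bonding homeomorphisms, so using all
pointed covers gives the same limit as using one representative per equivalence class. -/
def CompactUniversalCover : Type (u + 1) :=
  {x : ∀ c : PointedCover X x₀, c.carrier //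
    ∀ (c d : PointedCover X x₀) (h : c.carrier → d.carrier), c.IsBonding d h → h (x c) = x d}

instance : TopologicalSpace (CompactUniversalCover X x₀) :=
  inferInstanceAs (TopologicalSpace {x : ∀ c : PointedCover X x₀, c.carrier //
    ∀ (c d : PointedCover X x₀) (h : c.carrier → d.carrier), c.IsBonding d h → h (x c) = x d})

/-- The profinite fundamental group of `X`: the inverse limit of the groups of all covers of `X`
by continua, along the homomorphisms `θ` determined by the bonding maps `h` through
`θ g ∘ h = h ∘ g`. -/
def ProfiniteFundamentalGroup : Subgroup (∀ c : PointedCover X x₀, c.deck) where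
  carrier := {g | ∀ (c d : PointedCover X x₀) (h : c.carrier → d.carrier), c.IsBonding d h →
    ∀ y, (g d : Equiv.Perm d.carrier) (h y) = h ((g c : Equiv.Perm c.carrier) y)}
  mul_mem' := by
    intro a b ha hb c d h hh y
    simp only [Pi.mul_apply, Subgroup.coe_mul, Equiv.Perm.mul_apply]
    rw [hb c d h hh, ha c d h hh]
  one_mem' := by
    intro c d h _ y
    simp
  inv_mem' := by
    intro a ha c d h hh y
    simp only [Pi.inv_apply, Subgroup.coe_inv]
    rw [Equiv.Perm.inv_eq_iff_eq, ha c d h hh, ← Equiv.Perm.mul_apply, mul_inv_cancel, Equiv.Perm.one_apply]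

/-- The coordinatewise action of the profinite fundamental group on the compact universal
cover. -/
instance : MulAction (ProfiniteFundamentalGroup X x₀) (CompactUniversalCover X x₀) where
  smul g x := ⟨fun c => (g.1 c : Equiv.Perm c.carrier) (x.1 c), by
    intro c d h hh
    rw [← g.2 c d h hh, x.2 c d h hh]⟩
  one_smul _ := rfl
  mul_smul _ _ _ := rfl

/-- The projection of the inverse limit to `X`. -/
def CompactUniversalCover.proj [IsContinuum X] (x : CompactUniversalCover X x₀) : X :=
  x.1 (PointedCover.trivialCover X x₀)

end UniversalCover

/-- A compactly simply connected continuum: a continuum whose profinite fundamental group is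
trivial (for every choice of base point). -/
structure CompactlySimplyConnected (X : Type u) [TopologicalSpace X] : Prop where
  continuum : IsContinuum X
  trivial_group : ∀ x₀ : X, Subsingleton (ProfiniteFundamentalGroup X x₀)

/-! ### Generalized regular covering maps of uniform spaces -/

section Generalized

variable {Y : Type u} [UniformSpace Y]

/-- `G` acts isomorphically: there is a basis of `G`-invariant (symmetric) entourages. -/
def ActsIsomorphically (G : Subgroup (Equiv.Perm Y)) : Prop :=
  ∀ U ∈ 𝓤 Y, ∃ E ∈ 𝓤 Y, E ⊆ U ∧ (∀ x y, (x, y) ∈ E → (y, x) ∈ E) ∧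
    ∀ g ∈ G, Prod.map g g '' E = E

/-- The subgroup `N_E(G)` generated by the elements of `G` that move some point by less
than `E`. -/
def smallMoveSubgroup (G : Subgroup (Equiv.Perm Y)) (E : Set (Y × Y)) : Subgroup (Equiv.Perm Y) :=
  Subgroup.closure {g | g ∈ G ∧ ∃ x, (x, g x) ∈ E}

/-- `G` acts prodiscretely: for every entourage `E` there is an entourage `F` such that every
element of `N_F(G)` moves all points by less than `E`. -/
def ActsProdiscretely (G : Subgroup (Equiv.Perm Y)) : Prop :=
  ∀ E ∈ 𝓤 Y, ∃ F ∈ 𝓤 Y, ∀ g ∈ smallMoveSubgroup G F, ∀ x, (x, g x) ∈ E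

/-- `G` is complete in the uniformity of uniform convergence. -/
def IsCompleteGroup (G : Subgroup (Equiv.Perm Y)) : Prop :=
  IsComplete ((fun g : Equiv.Perm Y => (UniformFun.ofFun g : UniformFun Y Y)) ''
    (G : Set (Equiv.Perm Y)))

/-- `f : Y → X = Y / G` is a generalized regular covering map with deck group `G`: the group `G`
is complete and acts isomorphically and prodiscretely on `Y`, and `f` is the quotient map of the
action, with `X` carrying the quotient uniformity. -/
structure IsGeneralizedRegularCovering {X : Type v} [UniformSpace X]
    (f : Y → X) (G : Subgroup (Equiv.Perm Y)) : Prop where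
  isomorphic : ActsIsomorphically G
  prodiscrete : ActsProdiscretely G
  complete : IsCompleteGroup G
  surjective : Function.Surjective f
  fiber_eq_orbit : ∀ y z, f y = f z ↔ ∃ g ∈ G, g y = z
  uniformity_eq : 𝓤 X = Filter.map (Prod.map f f) (𝓤 Y)

end Generalized

-- The covers that are needed all come from one source. If a compact Hausdorff space maps onto a
-- continuum with fibres the orbits of a finite family of maps, each the identity or fixed-point
-- free, then the map is a covering, and the component of any point is a regular cover by a
-- continuum (`IsFiniteFreeQuotient.exists_pointedCover`). Applied to fibre products, this makes the
-- covers directed and lets a map from a compactly simply connected continuum lift to every cover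
-- (`CompactlySimplyConnected.exists_lift`). Compactness then gives surjective coordinates and
-- connectedness of the limit. Metrizability holds because countably many covers dominate all
-- others.
--
-- Uniqueness: the lifts of `f` to all covers assemble to a map into the limit. It is onto because
-- each lift is onto and the image is compact. It is injective because, for each entourage `E`,
-- dividing `Y` by a suitable `N_F(G)` gives a finite free quotient over `X` with `E`-small classes
-- (`exists_isFiniteFreeQuotient`), and this quotient is dominated by a cover of `X`. Comparing
-- orbits of one point identifies the groups.
--
-- Simple connectivity: a cover of the limit has a finite deck group, so it descends to a finite
-- cover of some `X_c`. The composite with the projection to `X` need not be regular, but a regular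
-- cover of `X` dominates it. Since the limit already maps to that cover, the given cover is trivial
-- (`eq_one_of_mem_deck`).

universe w

/-! ### Finite free quotients and their components -/

/-- A continuous surjection whose fibers are the orbits of a finite family of continuous self-maps
over the base, each of which is the identity or has no fixed points. -/
structure IsFiniteFreeQuotient {T : Type w} {B : Type v} [TopologicalSpace T] [TopologicalSpace B]
    (p : T → B) : Prop where
  continuous : Continuous p
  surjective : Function.Surjective p
  exists_family : ∃ S : Set (T → T), S.Finite ∧
    (∀ s ∈ S, Continuous s ∧ (∀ a, p (s a) = p a) ∧ (s = id ∨ ∀ a, s a ≠ a)) ∧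
    ∀ a b, p a = p b → ∃ s ∈ S, s a = b

namespace IsFiniteFreeQuotient

variable {T : Type w} {B : Type v} [TopologicalSpace T] [TopologicalSpace B] {p : T → B}

/-- The saturation of an open set is a union of preimages under the family, so `p` is open. Each
fixed-point-free member pushes a small neighbourhood off itself; by finiteness one neighbourhood
works for all of them, and `p` is injective there. -/
theorem isLocalHomeomorph [CompactSpace T] [T2Space T] [T2Space B]
    (hp : IsFiniteFreeQuotient p) : IsLocalHomeomorph p := by
  obtain ⟨S, hfin, hS, hfib⟩ := hp.exists_family
  have hquot : IsQuotientMap p := hp.continuous.isClosedMap.isQuotientMap hp.continuous hp.surjective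
  have hopen : IsOpenMap p := by
    intro U hU
    rw [← hquot.isOpen_preimage]
    have : p ⁻¹' (p '' U) = ⋃ s ∈ S, s ⁻¹' U := by
      ext a
      simp only [mem_preimage, mem_image, mem_iUnion, exists_prop]
      constructor
      · rintro ⟨b, hb, hba⟩
        obtain ⟨s, hs, rfl⟩ := hfib a b hba.symm
        exact ⟨s, hs, hb⟩
      · rintro ⟨s, hs, h⟩
        exact ⟨s a, h, (hS s hs).2.1 a⟩
    rw [this]
    exact isOpen_biUnion fun s hs => hU.preimage (hS s hs).1
  rw [isLocalHomeomorph_iff_isOpenEmbedding_restrict]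
  intro a
  have key : ∀ s ∈ S, ∀ᶠ N in (𝓝 a).smallSets, s = id ∨ ∀ x ∈ N, s x ∉ N := by
    intro s hs
    rcases (hS s hs).2.2 with h | h
    · exact Filter.Eventually.of_forall fun _ => Or.inl h
    · obtain ⟨V, W, hV, hW, haV, haW, hd⟩ := t2_separation (h a).symm
      refine Filter.eventually_smallSets.2 ⟨V ∩ s ⁻¹' W, Filter.inter_mem (hV.mem_nhds haV)
        ((hS s hs).1.continuousAt (hW.mem_nhds haW)), fun N hN => Or.inr fun x hx hsx => ?_⟩
      exact disjoint_left.1 hd (hN hsx).1 (hN hx).2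
  have key2 := (Filter.eventually_all_finite hfin).2 key
  obtain ⟨N, hN, hN'⟩ := Filter.eventually_smallSets.1 key2
  obtain ⟨U, hUN, hU, haU⟩ := mem_nhds_iff.1 hN
  refine ⟨U, hU.mem_nhds haU, IsOpenEmbedding.of_continuous_injective_isOpenMap
    (hp.continuous.comp continuous_subtype_val) ?_ (hopen.comp hU.isOpenMap_subtype_val)⟩
  rintro ⟨x, hx⟩ ⟨y, hy⟩ hxy
  obtain ⟨s, hs, rfl⟩ := hfib x y hxy
  rcases hN' U hUN s hs with rfl | h
  · rfl
  · exact absurd hy (h x hx)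

theorem isCoveringMap [CompactSpace T] [T2Space T] [T2Space B]
    (hp : IsFiniteFreeQuotient p) : IsCoveringMap p :=
  isLocalHomeomorph_iff_isCoveringMap.1 hp.isLocalHomeomorph

end IsFiniteFreeQuotient

/-- A compact Hausdorff space locally homeomorphic to a second countable space is metrizable. -/
theorem IsLocalHomeomorph.metrizableSpace_of_compactSpace {T : Type w} {B : Type v}
    [TopologicalSpace T] [TopologicalSpace B] {p : T → B} [CompactSpace T] [T2Space T]
    [SecondCountableTopology B] (hp : IsLocalHomeomorph p) :
    TopologicalSpace.MetrizableSpace T := by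
  have : ∀ x : T, ∃ U : Set T, IsOpen U ∧ x ∈ U ∧ SecondCountableTopology U := by
    intro x
    obtain ⟨e, hx, -⟩ := hp x
    exact ⟨e.source, e.open_source, hx, e.secondCountableTopology_source⟩
  choose U hU hxU hsc using this
  obtain ⟨t, ht⟩ := isCompact_univ.elim_finite_subcover U hU fun x _ => mem_iUnion.2 ⟨x, hxU x⟩
  have : SecondCountableTopology T := by
    refine TopologicalSpace.secondCountableTopology_of_countable_cover
      (U := fun i : t => U i) (fun i => hU i) ?_
    rw [← univ_subset_iff]
    intro x hx
    obtain ⟨i, hi, hxi⟩ := mem_iUnion₂.1 (ht hx)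
    exact mem_iUnion.2 ⟨⟨i, hi⟩, hxi⟩
  infer_instance

theorem IsContinuum.secondCountableTopology (X : Type u) [TopologicalSpace X] [IsContinuum X] :
    SecondCountableTopology X := by
  let := TopologicalSpace.metrizableSpaceMetric X
  infer_instance

/-- A clopen subset through a given point that is connected, in a finite free quotient over a
connected base. -/
theorem IsFiniteFreeQuotient.exists_isClopen_isConnected {T : Type w} {B : Type v}
    [TopologicalSpace T] [TopologicalSpace B] {p : T → B} [CompactSpace T] [T2Space T] [T2Space B]
    [PreconnectedSpace B] (hp : IsFiniteFreeQuotient p) (t : T) :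
    ∃ U : Set T, IsClopen U ∧ t ∈ U ∧ IsConnected U ∧ p '' U = univ := by
  have himage : ∀ U : Set T, IsClopen U → U.Nonempty → p '' U = univ := by
    intro U hU hne
    exact (IsClopen.eq_univ ⟨hp.continuous.isClosedMap _ hU.1,
      hp.isLocalHomeomorph.isOpenMap _ hU.2⟩ (hne.image p))
  obtain ⟨S, hfin, hS, hfib⟩ := hp.exists_family
  have hF : (p ⁻¹' {p t}).Finite := by
    refine (hfin.image fun s => s t).subset fun a ha => ?_
    obtain ⟨s, hs, h⟩ := hfib t a (mem_singleton_iff.1 ha).symm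
    exact ⟨s, hs, h⟩
  -- Every nonempty clopen set meets the finite fibre of `p t`, so a clopen set around `t` with
  -- fewest points in that fibre cannot be split further.
  have hex : ∃ n, ∃ U : Set T, IsClopen U ∧ t ∈ U ∧ (U ∩ p ⁻¹' {p t}).ncard = n :=
    ⟨_, univ, isClopen_univ, mem_univ _, rfl⟩
  classical
  obtain ⟨U, hU, htU, hn⟩ := Nat.find_spec hex
  have hmin : ∀ A : Set T, IsClopen A → t ∈ A → A ⊆ U → U ⊆ A := by
    intro A hA htA hAU
    by_contra hne
    have h1 := himage (U \ A) (hU.diff hA) (by rwa [sdiff_nonempty])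
    obtain ⟨b, hb, hbt⟩ : p t ∈ p '' (U \ A) := by rw [h1]; trivial
    refine Nat.find_min hex ?_ ⟨A, hA, htA, rfl⟩
    rw [← hn]
    refine ncard_lt_ncard ⟨inter_subset_inter_left _ hAU, fun h => hb.2 ?_⟩ (hF.inter_of_right U)
    exact (h ⟨hb.1, hbt⟩).1
  refine ⟨U, hU, htU, ⟨⟨t, htU⟩, ?_⟩, himage U hU ⟨t, htU⟩⟩
  rw [isPreconnected_iff_subset_of_fully_disjoint_closed hU.1]
  have hclopen : ∀ u v : Set T, IsClosed u → IsClosed v → U ⊆ u ∪ v → Disjoint u v →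
      IsClopen (U ∩ u) := by
    intro u v hu hv huv hd
    refine ⟨hU.1.inter hu, ?_⟩
    have : U ∩ u = U \ v := by
      ext x
      refine ⟨fun h => ⟨h.1, disjoint_left.1 hd h.2⟩, fun h => ⟨h.1, (huv h.1).resolve_right h.2⟩⟩
    rw [this]
    exact hU.2.sdiff hv
  intro u v hu hv huv hd
  rcases huv htU with h | h
  · exact Or.inl fun x hx => (hmin _ (hclopen u v hu hv huv hd) ⟨htU, h⟩ inter_subset_left hx).2
  · exact Or.inr fun x hx => (hmin _ (hclopen v u hv hu (by rwa [union_comm]) hd.symm) ⟨htU, h⟩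
      inter_subset_left hx).2

/-- Pointed covers live in the universe of the base, whereas `T` may not. A point is determined by
its image and by a member of the finite family carrying a chosen fibre point to it. -/
theorem IsFiniteFreeQuotient.small {T : Type w} {B : Type v}
    [TopologicalSpace T] [TopologicalSpace B] {p : T → B} (hp : IsFiniteFreeQuotient p) :
    Small.{v} T := by
  obtain ⟨S, hfin, hS, hfib⟩ := hp.exists_family
  have : Finite S := hfin
  choose σ hσ using hp.surjective
  choose s hs hs' using fun a : T => hfib (σ (p a)) a (hσ (p a))
  refine small_of_injective (β := B × S) (f := fun a => (p a, ⟨s a, hs a⟩)) ?_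
  intro a b hab
  simp only [Prod.mk.injEq, Subtype.mk.injEq] at hab
  rw [← hs' a, ← hs' b, hab.1, hab.2]

/-- The group of all homeomorphisms over the base. -/
def overHomeomorphGroup {C : Type w} {B : Type v} [TopologicalSpace C] (q : C → B) :
    Subgroup (Equiv.Perm C) where
  carrier := {σ | Continuous σ ∧ Continuous σ.symm ∧ ∀ a, q (σ a) = q a}
  mul_mem' := by
    rintro σ τ ⟨h1, h2, h3⟩ ⟨k1, k2, k3⟩
    exact ⟨h1.comp k1, k2.comp h2, fun a => (h3 _).trans (k3 a)⟩
  one_mem' := ⟨continuous_id, continuous_id, fun _ => rfl⟩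
  inv_mem' := by
    rintro σ ⟨h1, h2, h3⟩
    refine ⟨h2, h1, fun a => ?_⟩
    rw [← h3 (σ⁻¹ a), ← Equiv.Perm.mul_apply, mul_inv_cancel, Equiv.Perm.one_apply]

/-- By uniqueness of lifts, a self-map over the base sending `a` to `b` and one sending `b` to `a`
are mutually inverse. The same uniqueness gives freeness. -/
theorem IsCoveringMap.isRegularCovering_of_homogeneous {C : Type w} {B : Type v}
    [TopologicalSpace C] [TopologicalSpace B] [PreconnectedSpace C] {q : C → B}
    (hq : IsCoveringMap q) (hsurj : Function.Surjective q)
    (hom : ∀ a b, q a = q b → ∃ s : C → C, Continuous s ∧ (∀ x, q (s x) = q x) ∧ s a = b) :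
    IsRegularCovering q (overHomeomorphGroup q) where
  isCoveringMap := hq
  isQuotientMap := hq.isQuotientMap hsurj
  continuous_of_mem := fun g hg => hg.1
  free := by
    intro g hg y hy
    ext x
    exact congrFun (hq.eq_of_comp_eq hg.1 continuous_id (funext hg.2.2) y hy) x
  fiber_eq_orbit := by
    intro a b
    constructor
    · intro hab
      obtain ⟨s, hs, hqs, hsa⟩ := hom a b hab
      obtain ⟨r, hr, hqr, hrb⟩ := hom b a hab.symm
      have h1 : r ∘ s = id := hq.eq_of_comp_eq (hr.comp hs) continuous_id
        (funext fun x => (hqr _).trans (hqs x)) a (by simp [hsa, hrb])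
      have h2 : s ∘ r = id := hq.eq_of_comp_eq (hs.comp hr) continuous_id
        (funext fun x => (hqs _).trans (hqr x)) b (by simp [hsa, hrb])
      exact ⟨⟨s, r, congrFun h1, congrFun h2⟩, ⟨hs, hr, hqs⟩, hsa⟩
    · rintro ⟨g, hg, rfl⟩
      exact (hg.2.2 a).symm

/-- The component of a point in a finite free quotient over a continuum is a pointed cover. -/
theorem IsFiniteFreeQuotient.exists_pointedCover {T : Type w} {B : Type v}
    [TopologicalSpace T] [TopologicalSpace B] {p : T → B} [CompactSpace T] [T2Space T]
    [IsContinuum B] (hp : IsFiniteFreeQuotient p) {t : T} {b : B} (ht : p t = b) :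
    ∃ (c : PointedCover B b) (j : c.carrier → T), Continuous j ∧ (∀ a, p (j a) = c.proj a) ∧
      j c.base = t := by
  obtain ⟨U, hU, htU, hconn, himage⟩ := hp.exists_isClopen_isConnected t
  have : Small.{v} T := hp.small
  have : Small.{v} U := inferInstance
  have : ConnectedSpace U := isConnected_iff_connectedSpace.1 hconn
  have : CompactSpace U := isCompact_iff_compactSpace.1 hU.1.isCompact
  let e : U ≃ₜ Shrink.{v} U := Shrink.homeomorph U
  have : CompactSpace (Shrink.{v} U) := e.compactSpace
  have : T2Space (Shrink.{v} U) := e.t2Space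
  have : ConnectedSpace (Shrink.{v} U) := e.surjective.connectedSpace e.continuous
  let j : Shrink.{v} U → T := fun a => (e.symm a : T)
  have hj : Continuous j := continuous_subtype_val.comp e.symm.continuous
  have hlocal : IsLocalHomeomorph (p ∘ j) := hp.isLocalHomeomorph.comp
    ((hU.2.isOpenEmbedding_subtypeVal.isLocalHomeomorph).comp e.symm.isLocalHomeomorph)
  have hcov : IsCoveringMap (p ∘ j) := isLocalHomeomorph_iff_isCoveringMap.1 hlocal
  have := IsContinuum.secondCountableTopology B
  have := hlocal.metrizableSpace_of_compactSpace
  have hreg : IsRegularCovering (p ∘ j) (overHomeomorphGroup (p ∘ j)) := by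
    refine hcov.isRegularCovering_of_homogeneous ?_ ?_
    · intro x
      obtain ⟨y, hy, rfl⟩ : x ∈ p '' U := by rw [himage]; trivial
      exact ⟨e ⟨y, hy⟩, by simp [j]⟩
    · intro a a' haa'
      obtain ⟨S, hfin, hS, hfib⟩ := hp.exists_family
      obtain ⟨s, hs, hsa⟩ := hfib (j a) (j a') haa'
      -- The part of the connected component that `s` keeps inside `U` is clopen and contains `a`,
      -- hence is everything.
      have hmem : ∀ x : Shrink.{v} U, s (j x) ∈ U := by
        have h1 : IsClopen ((s ∘ j) ⁻¹' U) := hU.preimage ((hS s hs).1.comp hj)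
        have h2 := h1.eq_univ ⟨a, by
          change s (j a) ∈ U
          rw [hsa]
          exact (e.symm a').2⟩
        intro x
        have : x ∈ (s ∘ j) ⁻¹' U := by rw [h2]; trivial
        exact this
      refine ⟨fun x => e ⟨s (j x), hmem x⟩, ?_, ?_, ?_⟩
      · exact e.continuous.comp (((hS s hs).1.comp hj).subtype_mk _)
      · intro x
        simp only [Function.comp, j, Homeomorph.symm_apply_apply]
        exact (hS s hs).2.1 _
      · exact e.toEquiv.eq_symm_apply.1 (Subtype.ext hsa)
  refine ⟨{ carrier := Shrink.{v} U
            continuum := {}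
            proj := p ∘ j
            deck := _
            regular := hreg
            base := e ⟨t, htU⟩
            proj_base := by simp [j, ht] }, j, hj, fun _ => rfl, by simp [j]⟩

/-! ### Lifts and directedness of covers -/

namespace PointedCover

variable {B : Type v} [TopologicalSpace B] {b : B}

theorem isCoveringMap_proj (c : PointedCover B b) : IsCoveringMap c.proj := c.regular.isCoveringMap

theorem surjective_proj (c : PointedCover B b) : Function.Surjective c.proj :=
  c.regular.isQuotientMap.surjective

theorem proj_apply_of_mem_deck (c : PointedCover B b) {g : Equiv.Perm c.carrier} (hg : g ∈ c.deck)
    (y : c.carrier) : c.proj (g y) = c.proj y :=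
  ((c.regular.fiber_eq_orbit y (g y)).2 ⟨g, hg, rfl⟩).symm

/-- Two lifts of a map from a connected space that agree at one point are equal. -/
theorem lift_unique (c : PointedCover B b) {A : Type w} [TopologicalSpace A] [PreconnectedSpace A]
    {k l : A → c.carrier} (hk : Continuous k) (hl : Continuous l)
    (h : ∀ a, c.proj (k a) = c.proj (l a)) {a : A} (ha : k a = l a) (x : A) : k x = l x :=
  congrFun (c.isCoveringMap_proj.eq_of_comp_eq hk hl (funext h) a ha) x

theorem deck_ext (c : PointedCover B b) {g g' : c.deck} {y : c.carrier}
    (h : (g : Equiv.Perm c.carrier) y = (g' : Equiv.Perm c.carrier) y) : g = g' := by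
  have h1 : (g'⁻¹ * g : c.deck) = 1 := by
    ext1
    refine c.regular.free _ (g'⁻¹ * g).2 y ?_
    simp [h]
  exact (inv_mul_eq_one.1 h1).symm

/-- By freeness the group injects into the fibre over `b`, which is both compact and discrete. -/
theorem finite_deck [T2Space B] (c : PointedCover B b) : Finite c.deck := by
  have h1 : IsCompact (c.proj ⁻¹' {b}) :=
    (isClosed_singleton.preimage c.isCoveringMap_proj.continuous).isCompact
  have h2 : DiscreteTopology (c.proj ⁻¹' {b}) := (c.isCoveringMap_proj b).discreteTopology_fiber
  have h3 : Finite (c.proj ⁻¹' {b}) := by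
    have := isCompact_iff_compactSpace.1 h1
    exact finite_of_compact_of_discrete
  refine Finite.of_injective (fun g : c.deck => (⟨(g : Equiv.Perm c.carrier) c.base, by
    simp [c.proj_apply_of_mem_deck g.2, c.proj_base]⟩ : c.proj ⁻¹' {b})) ?_
  intro g g' h
  exact c.deck_ext (Subtype.ext_iff.1 h)

/-- A lift of an open map from a nonempty compact space to a cover by a continuum is onto. -/
theorem surjective_of_isOpenMap_proj_comp [T2Space B] (c : PointedCover B b) {A : Type w}
    [TopologicalSpace A] [CompactSpace A] [Nonempty A] {k : A → c.carrier} (hk : Continuous k)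
    (h : IsOpenMap fun a => c.proj (k a)) : Function.Surjective k := by
  -- Near `k a` the projection is injective, so openness of the composite passes back to `k`.
  have hopen : IsOpenMap k := by
    rw [isOpenMap_iff_nhds_le] at h ⊢
    intro a
    obtain ⟨e, he, heq⟩ := c.isCoveringMap_proj.isLocalHomeomorph (k a)
    intro N hN
    have h1 : k ⁻¹' N ∩ k ⁻¹' e.source ∈ 𝓝 a := Filter.inter_mem hN
      (hk.continuousAt (e.open_source.mem_nhds he))
    have h2 : (fun a => c.proj (k a)) '' (k ⁻¹' N ∩ k ⁻¹' e.source) ∈ 𝓝 (c.proj (k a)) :=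
      h a (Filter.image_mem_map h1)
    have h3 := c.isCoveringMap_proj.continuous.continuousAt h2
    filter_upwards [h3, e.open_source.mem_nhds he] with x hx hxe
    obtain ⟨a', ⟨h4, h5⟩, h6⟩ := hx
    have : k a' = x := e.injOn h5 hxe (by rw [← heq]; exact h6)
    rw [← this]
    exact h4
  rw [← range_eq_univ]
  exact IsClopen.eq_univ ⟨(isCompact_range hk).isClosed, hopen.isOpen_range⟩ (range_nonempty k)

theorem isBonding_of_continuous [T2Space B] {c d : PointedCover B b} {h : c.carrier → d.carrier}
    (hc : Continuous h) (hp : ∀ y, d.proj (h y) = c.proj y) (hb : h c.base = d.base) :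
    c.IsBonding d h where
  continuous := hc
  surjective := by
    have : Nonempty c.carrier := ⟨c.base⟩
    refine d.surjective_of_isOpenMap_proj_comp hc ?_
    simp only [hp]
    exact c.isCoveringMap_proj.isOpenMap
  proj_comp := hp
  map_base := hb

theorem IsBonding.comp {c d e : PointedCover B b} {h : c.carrier → d.carrier}
    {k : d.carrier → e.carrier} (hk : d.IsBonding e k) (hh : c.IsBonding d h) :
    c.IsBonding e (k ∘ h) where
  continuous := hk.continuous.comp hh.continuous
  surjective := hk.surjective.comp hh.surjective
  proj_comp := fun y => (hk.proj_comp _).trans (hh.proj_comp y)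
  map_base := by simp [hh.map_base, hk.map_base]

theorem IsBonding.eq {c d : PointedCover B b} {h k : c.carrier → d.carrier}
    (hh : c.IsBonding d h) (hk : c.IsBonding d k) : h = k :=
  funext fun x => d.lift_unique hh.continuous hk.continuous
    (fun a => (hh.proj_comp a).trans (hk.proj_comp a).symm)
    (hh.map_base.trans hk.map_base.symm) x

theorem isBonding_id (c : PointedCover B b) : c.IsBonding c id :=
  ⟨continuous_id, Function.surjective_id, fun _ => rfl, rfl⟩

theorem isBonding_trivialCover [IsContinuum B] (c : PointedCover B b) :
    c.IsBonding (trivialCover B b) c.proj :=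
  ⟨c.isCoveringMap_proj.continuous, c.surjective_proj, fun _ => rfl, c.proj_base⟩

/-- The covers by continua are directed. -/
theorem exists_isBonding_isBonding [IsContinuum B] (c d : PointedCover B b) :
    ∃ (e : PointedCover B b) (h : e.carrier → c.carrier) (k : e.carrier → d.carrier),
      e.IsBonding c h ∧ e.IsBonding d k := by
  -- The product of the two deck groups acts freely on the fibre product; the component of the base
  -- point dominates both covers.
  let T : Set (c.carrier × d.carrier) := {x | c.proj x.1 = d.proj x.2}
  have hpc := c.isCoveringMap_proj.continuous
  have hpd := d.isCoveringMap_proj.continuous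
  have hclosed : IsClosed T :=
    isClosed_eq (hpc.comp continuous_fst) (hpd.comp continuous_snd)
  have : CompactSpace T := isCompact_iff_compactSpace.1 hclosed.isCompact
  have hT : IsFiniteFreeQuotient fun x : T => c.proj x.1.1 := by
    refine ⟨by fun_prop, ?_, ?_⟩
    · intro x
      obtain ⟨y, rfl⟩ := c.surjective_proj x
      obtain ⟨z, hz⟩ := d.surjective_proj (c.proj y)
      exact ⟨⟨(y, z), hz.symm⟩, rfl⟩
    · have := c.finite_deck
      have := d.finite_deck
      refine ⟨range fun (g : c.deck × d.deck) (x : T) => (⟨((g.1 : Equiv.Perm _) x.1.1,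
        (g.2 : Equiv.Perm _) x.1.2), by
          change c.proj _ = d.proj _
          rw [c.proj_apply_of_mem_deck g.1.2, d.proj_apply_of_mem_deck g.2.2]
          exact x.2⟩ : T),
        finite_range _, ?_, ?_⟩
      · rintro _ ⟨g, rfl⟩
        refine ⟨?_, ?_, ?_⟩
        · have h1 := c.regular.continuous_of_mem _ g.1.2
          have h2 := d.regular.continuous_of_mem _ g.2.2
          fun_prop
        · exact fun x => c.proj_apply_of_mem_deck g.1.2 _
        · by_cases h : g = 1
          · left
            subst h
            rfl
          · right
            intro a ha
            have h1 := congrArg (fun x : T => x.1.1) ha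
            have h2 := congrArg (fun x : T => x.1.2) ha
            exact h (Prod.ext (Subtype.ext (c.regular.free _ g.1.2 _ h1))
              (Subtype.ext (d.regular.free _ g.2.2 _ h2)))
      · intro x y hxy
        obtain ⟨g, hg, h⟩ := (c.regular.fiber_eq_orbit x.1.1 y.1.1).1 hxy
        obtain ⟨g', hg', h'⟩ := (d.regular.fiber_eq_orbit x.1.2 y.1.2).1
          (x.2.symm.trans (hxy.trans y.2))
        exact ⟨_, ⟨(⟨g, hg⟩, ⟨g', hg'⟩), rfl⟩, Subtype.ext (Prod.ext h h')⟩
  obtain ⟨e, j, hj, hpj, hjb⟩ := hT.exists_pointedCover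
    (t := ⟨(c.base, d.base), c.proj_base.trans d.proj_base.symm⟩) c.proj_base
  refine ⟨e, fun a => (j a).1.1, fun a => (j a).1.2, isBonding_of_continuous (by fun_prop) hpj
    (by simp [hjb]), isBonding_of_continuous (by fun_prop) (fun y => ?_) (by simp [hjb])⟩
  rw [← hpj]
  exact (j y).2.symm

end PointedCover

/-! ### Compactness, connectedness and the group action of the inverse limit -/

namespace CompactUniversalCover

variable {X : Type u} [TopologicalSpace X] {x₀ : X}

theorem continuous_coord (c : PointedCover X x₀) :
    Continuous fun x : CompactUniversalCover X x₀ => x.1 c :=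
  (continuous_apply c).comp continuous_subtype_val

instance : T2Space (CompactUniversalCover X x₀) :=
  inferInstanceAs (T2Space {x : ∀ c : PointedCover X x₀, c.carrier //
    ∀ (c d : PointedCover X x₀) (h : c.carrier → d.carrier), c.IsBonding d h → h (x c) = x d})

instance : CompactSpace (CompactUniversalCover X x₀) := by
  have h : IsClosed {x : ∀ c : PointedCover X x₀, c.carrier |
      ∀ (c d : PointedCover X x₀) (h : c.carrier → d.carrier), c.IsBonding d h →
        h (x c) = x d} := by
    simp only [ofPred_forall]
    exact isClosed_iInter fun c => isClosed_iInter fun d => isClosed_iInter fun h =>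
      isClosed_iInter fun hh => isClosed_eq (hh.continuous.comp (continuous_apply c))
        (continuous_apply d)
  exact isCompact_iff_compactSpace.1 h.isCompact

theorem smul_right_injective {γ δ : ProfiniteFundamentalGroup X x₀}
    {x : CompactUniversalCover X x₀} (h : γ • x = δ • x) : γ = δ :=
  Subtype.ext (funext fun c => c.deck_ext (congrFun (Subtype.ext_iff.1 h) c))

variable [IsContinuum X]

theorem proj_coord (x : CompactUniversalCover X x₀) (c : PointedCover X x₀) :
    c.proj (x.1 c) = proj X x₀ x :=
  x.2 c (PointedCover.trivialCover X x₀) c.proj c.isBonding_trivialCover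

/-- The projections of the inverse limit onto the covers are onto. -/
theorem exists_coord_eq (c : PointedCover X x₀) (z : c.carrier) :
    ∃ x : CompactUniversalCover X x₀, x.1 c = z := by
  classical
  -- `t d` demands coherence only for the bonding maps out of `d`. These closed sets are directed,
  -- and a point common to all of them is fully coherent because the covers above `c` are cofinal.
  let t : {d : PointedCover X x₀ // ∃ h, d.IsBonding c h} → Set (∀ c : PointedCover X x₀, c.carrier) :=
    fun d => {x | x c = z ∧ ∀ (e : PointedCover X x₀) (h : d.1.carrier → e.carrier),
      d.1.IsBonding e h → h (x d.1) = x e}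
  have : Nonempty {d : PointedCover X x₀ // ∃ h, d.IsBonding c h} := ⟨⟨c, id, c.isBonding_id⟩⟩
  have hclosed : ∀ d, IsClosed (t d) := by
    intro d
    refine (isClosed_eq (continuous_apply c) continuous_const).inter (s₂ := {x | ∀ (e :
      PointedCover X x₀) (h : d.1.carrier → e.carrier), d.1.IsBonding e h → h (x d.1) = x e}) ?_
    simp only [ofPred_forall]
    exact isClosed_iInter fun e => isClosed_iInter fun h => isClosed_iInter fun hh =>
      isClosed_eq (hh.continuous.comp (continuous_apply d.1)) (continuous_apply e)
  have hdir : Directed (· ⊇ ·) t := by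
    rintro ⟨d₁, k₁, hk₁⟩ ⟨d₂, k₂, hk₂⟩
    obtain ⟨e, l₁, l₂, hl₁, hl₂⟩ := d₁.exists_isBonding_isBonding d₂
    refine ⟨⟨e, k₁ ∘ l₁, hk₁.comp hl₁⟩, ?_, ?_⟩
    · rintro x ⟨hx, hx'⟩
      refine ⟨hx, fun f h hh => ?_⟩
      rw [← hx' f _ (hh.comp hl₁), ← hx' d₁ _ hl₁]
      rfl
    · rintro x ⟨hx, hx'⟩
      refine ⟨hx, fun f h hh => ?_⟩
      rw [← hx' f _ (hh.comp hl₂), ← hx' d₂ _ hl₂]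
      rfl
  have hne : ∀ d, (t d).Nonempty := by
    rintro ⟨d, k, hk⟩
    obtain ⟨y, hy⟩ := hk.surjective z
    -- The value `e.base` is a filler: `t d` puts no condition on covers that `d` does not dominate,
    -- apart from the value at `c`, which it does dominate.
    let x : ∀ e : PointedCover X x₀, e.carrier := fun e =>
      if h : ∃ h, d.IsBonding e h then h.choose y else e.base
    have hx : ∀ (e : PointedCover X x₀) (h : d.carrier → e.carrier), d.IsBonding e h →
        x e = h y := by
      intro e h hh
      have hex : ∃ h, d.IsBonding e h := ⟨h, hh⟩
      simp only [x, dif_pos hex]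
      rw [hex.choose_spec.eq hh]
    refine ⟨x, (hx c k hk).trans hy, fun e h hh => ?_⟩
    rw [hx e h hh, hx d id d.isBonding_id]
    rfl
  obtain ⟨x, hx⟩ := IsCompact.nonempty_iInter_of_directed_nonempty_isCompact_isClosed t hdir hne
    (fun d => (hclosed d).isCompact) hclosed
  rw [mem_iInter] at hx
  refine ⟨⟨x, fun a b h hh => ?_⟩, (hx ⟨c, id, c.isBonding_id⟩).1⟩
  obtain ⟨e, k, l, hk, hl⟩ := a.exists_isBonding_isBonding c
  have h1 := (hx ⟨e, l, hl⟩).2 a k hk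
  have h2 := (hx ⟨e, l, hl⟩).2 b (h ∘ k) (hh.comp hk)
  rw [← h1, ← h2]
  rfl

instance : Nonempty (CompactUniversalCover X x₀) :=
  let ⟨x, _⟩ := exists_coord_eq (PointedCover.trivialCover X x₀) x₀
  ⟨x⟩

/-- Points with the same coordinate in a large enough cover are close to each other. -/
theorem exists_forall_coord_eq_mem
    {E : Set (CompactUniversalCover X x₀ × CompactUniversalCover X x₀)} (hE : IsOpen E)
    (hdiag : ∀ x, (x, x) ∈ E) :
    ∃ c : PointedCover X x₀, ∀ x y : CompactUniversalCover X x₀, x.1 c = y.1 c → (x, y) ∈ E := by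
  -- If no cover worked, compactness would give a pair outside `E` agreeing in every coordinate,
  -- that is, a diagonal point.
  let t : PointedCover X x₀ → Set (CompactUniversalCover X x₀ × CompactUniversalCover X x₀) :=
    fun c => {z | z.1.1 c = z.2.1 c} ∩ Eᶜ
  by_contra! hcon
  have : Nonempty (PointedCover X x₀) := ⟨PointedCover.trivialCover X x₀⟩
  have hclosed : ∀ c, IsClosed (t c) := fun c =>
    (isClosed_eq ((continuous_coord c).comp continuous_fst)
      ((continuous_coord c).comp continuous_snd)).inter hE.isClosed_compl
  have hdir : Directed (· ⊇ ·) t := by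
    intro c d
    obtain ⟨e, h, k, hh, hk⟩ := c.exists_isBonding_isBonding d
    refine ⟨e, ?_, ?_⟩
    · rintro ⟨x, y⟩ ⟨h1, h2⟩
      refine ⟨?_, h2⟩
      change x.1 c = y.1 c
      rw [← x.2 e c h hh, ← y.2 e c h hh]
      exact congrArg h h1
    · rintro ⟨x, y⟩ ⟨h1, h2⟩
      refine ⟨?_, h2⟩
      change x.1 d = y.1 d
      rw [← x.2 e d k hk, ← y.2 e d k hk]
      exact congrArg k h1
  have hne : ∀ d, (t d).Nonempty := by
    intro c
    obtain ⟨x, y, h1, h2⟩ := hcon c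
    exact ⟨(x, y), h1, h2⟩
  obtain ⟨⟨x, y⟩, hxy⟩ := IsCompact.nonempty_iInter_of_directed_nonempty_isCompact_isClosed t hdir hne
    (fun d => (hclosed d).isCompact) hclosed
  rw [mem_iInter] at hxy
  have : x = y := Subtype.ext (funext fun c => (hxy c).1)
  subst this
  exact (hxy (PointedCover.trivialCover X x₀)).2 (hdiag x)

instance : ConnectedSpace (CompactUniversalCover X x₀) where
  toNonempty := inferInstance
  toPreconnectedSpace := by
    rw [preconnectedSpace_iff_clopen]
    intro A hA
    by_contra! hne
    -- A clopen set is a union of fibres of a single coordinate, so a separation of the limit would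
    -- descend to one of the connected space `c.carrier`.
    obtain ⟨c, hc⟩ := exists_forall_coord_eq_mem (E := {z | z.1 ∈ A ↔ z.2 ∈ A}) (by
      have : {z : CompactUniversalCover X x₀ × CompactUniversalCover X x₀ | z.1 ∈ A ↔ z.2 ∈ A} =
          A ×ˢ A ∪ Aᶜ ×ˢ Aᶜ := by
        ext z
        simp only [mem_ofPred_eq, mem_union, mem_prod, mem_compl_iff]
        tauto
      rw [this]
      exact (hA.2.prod hA.2).union (hA.compl.2.prod hA.compl.2)) fun x => Iff.rfl
    let π := fun x : CompactUniversalCover X x₀ => x.1 c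
    have hπ : Continuous π := continuous_coord c
    have hcompl : π '' Aᶜ = (π '' A)ᶜ := by
      ext z
      constructor
      · rintro ⟨x, hx, rfl⟩ ⟨y, hy, hyx⟩
        exact hx ((hc y x hyx).1 hy)
      · intro hz
        obtain ⟨x, rfl⟩ := exists_coord_eq c z
        exact ⟨x, fun hx => hz ⟨x, hx, rfl⟩, rfl⟩
    have h1 : IsClopen (π '' A) := by
      refine ⟨(hA.1.isCompact.image hπ).isClosed, ?_⟩
      rw [← isClosed_compl_iff, ← hcompl]
      exact (hA.compl.1.isCompact.image hπ).isClosed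
    have h2 := h1.eq_univ (hne.1.image _)
    obtain ⟨x, hx⟩ := nonempty_compl.2 hne.2
    have h3 : π x ∈ (π '' A)ᶜ := hcompl ▸ mem_image_of_mem π hx
    exact h3 (h2 ▸ mem_univ _)

/-- The deck transformations found in the separate coordinates are automatically compatible: the two
lifts to be compared agree at `x.1 c`. -/
theorem exists_smul_eq {x y : CompactUniversalCover X x₀} (h : proj X x₀ x = proj X x₀ y) :
    ∃ γ : ProfiniteFundamentalGroup X x₀, γ • x = y := by
  have : ∀ c : PointedCover X x₀, ∃ g ∈ c.deck, g (x.1 c) = y.1 c := fun c =>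
    (c.regular.fiber_eq_orbit _ _).1 (by rw [proj_coord, proj_coord, h])
  choose g hg hgx using this
  refine ⟨⟨fun c => ⟨g c, hg c⟩, ?_⟩, Subtype.ext (funext hgx)⟩
  intro c d h hh z
  refine d.lift_unique (k := fun z => g d (h z)) (l := fun z => h (g c z)) (a := x.1 c)
    ((d.regular.continuous_of_mem _ (hg d)).comp hh.continuous)
    (hh.continuous.comp (c.regular.continuous_of_mem _ (hg c))) (fun a => ?_) ?_ z
  · rw [d.proj_apply_of_mem_deck (hg d), hh.proj_comp, hh.proj_comp,
      c.proj_apply_of_mem_deck (hg c)]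
  · rw [hgx, x.2 c d h hh, y.2 c d h hh, hgx]

theorem proj_smul (γ : ProfiniteFundamentalGroup X x₀) (x : CompactUniversalCover X x₀) :
    proj X x₀ (γ • x) = proj X x₀ x := by
  rw [← proj_coord x (PointedCover.trivialCover X x₀),
    ← proj_coord _ (PointedCover.trivialCover X x₀)]
  exact PointedCover.proj_apply_of_mem_deck _ (γ.1 _).2 _

end CompactUniversalCover

/-- The covers of a compactly simply connected continuum are trivial. -/
theorem CompactlySimplyConnected.injective_proj {X : Type u} [TopologicalSpace X]
    (hX : CompactlySimplyConnected X) {x₀ : X} (c : PointedCover X x₀) :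
    Function.Injective c.proj := by
  have := hX.continuum
  have hsub := hX.trivial_group x₀
  -- Each deck transformation is a coordinate of an element of the profinite group: lift `c.base`
  -- and its image to the limit and join the two lifts by the action.
  have hdeck : ∀ g : c.deck, g = 1 := by
    intro g
    obtain ⟨x, hx⟩ := CompactUniversalCover.exists_coord_eq c c.base
    obtain ⟨y, hy⟩ := CompactUniversalCover.exists_coord_eq c ((g : Equiv.Perm c.carrier) c.base)
    obtain ⟨γ, hγ⟩ := CompactUniversalCover.exists_smul_eq (x := x) (y := y) (by
      rw [← CompactUniversalCover.proj_coord x c, ← CompactUniversalCover.proj_coord y c, hx, hy,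
        c.proj_apply_of_mem_deck g.2])
    rw [Subsingleton.elim γ 1, one_smul] at hγ
    refine c.deck_ext (y := c.base) ?_
    rw [← hy, ← hγ, hx]
    rfl
  intro y z hyz
  obtain ⟨g, hg, rfl⟩ := (c.regular.fiber_eq_orbit y z).1 hyz
  have := Subtype.ext_iff.1 (hdeck ⟨g, hg⟩)
  simp only at this
  rw [this]
  rfl

/-! ### Countability of covers and metrizability of the limit -/

theorem continuous_of_isClosed_setOf_eq {A : Type u} {B : Type v} [TopologicalSpace A]
    [TopologicalSpace B] [CompactSpace B] {h : A → B} (hh : IsClosed {z : A × B | h z.1 = z.2}) :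
    Continuous h := by
  rw [continuous_iff_isClosed]
  intro C hC
  have : h ⁻¹' C = Prod.fst '' ({z : A × B | h z.1 = z.2} ∩ Prod.snd ⁻¹' C) := by
    ext a
    constructor
    · exact fun ha => ⟨(a, h a), ⟨rfl, ha⟩, rfl⟩
    · rintro ⟨⟨a, b⟩, ⟨h1, h2⟩, rfl⟩
      change h a = b at h1
      subst h1
      exact h2
  rw [this]
  exact isClosedMap_fst_of_compactSpace _ (hh.inter (hC.preimage continuous_snd))

namespace PointedCover

variable {X : Type u} [TopologicalSpace X] {x₀ : X}

/-- A finite family of pairs of open sets that determines a cover up to isomorphism. -/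
def IsCode {M : Type v} [MetricSpace M] (c : PointedCover X x₀) (k : Set (Set X × Set M) × ℕ) :
    Prop :=
  ∃ u : c.carrier → M, Continuous u ∧
    (∀ a b, a ≠ b → c.proj a = c.proj b → 1 / ((k.2 : ℝ) + 1) < dist (u a) (u b)) ∧
    (∀ a, ∃ W ∈ k.1, c.proj a ∈ W.1 ∧ u a ∈ W.2) ∧
    (∀ W ∈ k.1, ∀ x ∈ W.1, ∃ a, c.proj a = x ∧ u a ∈ W.2) ∧
    ∀ W ∈ k.1, ∀ v ∈ W.2, ∀ v' ∈ W.2, dist v v' < 1 / ((k.2 : ℝ) + 1) / 3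

/-- Points in one fibre of `d` have images more than `ε` apart, so at most one of them is within `ε
/ 3` of `u a`. The common code supplies one, and the resulting map has closed graph. -/
theorem IsCode.exists_isBonding [T2Space X] {M : Type v} [MetricSpace M] {c d : PointedCover X x₀}
    {k : Set (Set X × Set M) × ℕ} (hc : c.IsCode k) (hd : d.IsCode k) :
    ∃ h, c.IsBonding d h := by
  obtain ⟨u, hu, -, hcov, -, hsmall⟩ := hc
  obtain ⟨v, hv, hsep, -, hlift, -⟩ := hd
  set ε : ℝ := 1 / ((k.2 : ℝ) + 1)
  have hε : 0 < ε := by positivity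
  have : ∀ a, ∃ b, d.proj b = c.proj a ∧ dist (u a) (v b) < ε / 3 := by
    intro a
    obtain ⟨W, hW, h1, h2⟩ := hcov a
    obtain ⟨b, hb, hb'⟩ := hlift W hW _ h1
    exact ⟨b, hb, hsmall W hW _ h2 _ hb'⟩
  choose h hproj hdist using this
  have hcont : Continuous h := by
    apply continuous_of_isClosed_setOf_eq
    have heq : {z : c.carrier × d.carrier | h z.1 = z.2} =
        {z | d.proj z.2 = c.proj z.1} ∩ {z | dist (u z.1) (v z.2) ≤ ε / 3} := by
      ext ⟨a, b⟩
      constructor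
      · rintro h1
        change h a = b at h1
        subst h1
        exact ⟨hproj a, (hdist a).le⟩
      · rintro ⟨h1, h2⟩
        change d.proj b = c.proj a at h1
        change dist (u a) (v b) ≤ ε / 3 at h2
        change h a = b
        by_contra hne
        have h3 := hsep _ _ hne ((hproj a).trans h1.symm)
        have h4 := dist_triangle_left (v (h a)) (v b) (u a)
        have h5 := hdist a
        linarith
    rw [heq]
    have h1 := c.isCoveringMap_proj.continuous
    have h2 := d.isCoveringMap_proj.continuous
    exact (isClosed_eq (by fun_prop) (by fun_prop)).inter
      (isClosed_le (by fun_prop) continuous_const)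
  -- A code ignores base points; a deck transformation corrects this.
  obtain ⟨g, hg, hgb⟩ := (d.regular.fiber_eq_orbit (h c.base) d.base).1 (by
    rw [hproj, c.proj_base, d.proj_base])
  exact ⟨g ∘ h, isBonding_of_continuous ((d.regular.continuous_of_mem g hg).comp hcont)
    (fun y => (d.proj_apply_of_mem_deck hg _).trans (hproj y)) hgb⟩

/-- The nontrivial elements of the deck group move all points by at least a fixed distance. -/
theorem exists_pos_lt_dist [T2Space X] {M : Type v} [MetricSpace M] (c : PointedCover X x₀)
    {u : c.carrier → M} (hu : Continuous u) (hinj : Function.Injective u) :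
    ∃ ε > 0, ∀ g : c.deck, g ≠ 1 → ∀ a, ε < dist (u a) (u ((g : Equiv.Perm _) a)) := by
  have hfin := c.finite_deck
  have hev : ∀ᶠ ε : ℝ in 𝓝[>] 0, ∀ g : c.deck, g ≠ 1 → ∀ a,
      ε < dist (u a) (u ((g : Equiv.Perm _) a)) := by
    rw [Filter.eventually_all]
    intro g
    by_cases hg : g = 1
    · exact Filter.Eventually.of_forall fun _ h => absurd hg h
    have hcont : Continuous fun a => dist (u a) (u ((g : Equiv.Perm c.carrier) a)) :=
      hu.dist (hu.comp (c.regular.continuous_of_mem g g.2))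
    obtain ⟨a, -, ha⟩ := isCompact_univ.exists_isMinOn ⟨c.base, mem_univ _⟩ hcont.continuousOn
    have hpos : 0 < dist (u a) (u ((g : Equiv.Perm c.carrier) a)) :=
      dist_pos.2 fun h => hg (Subtype.ext (c.regular.free g g.2 a (hinj h).symm))
    filter_upwards [Ioo_mem_nhdsGT hpos] with ε hε _ b
    exact hε.2.trans_le (ha (mem_univ b))
  exact (hev.and self_mem_nhdsWithin).exists.imp fun ε h => ⟨h.2, h.1⟩

theorem exists_isCode [IsContinuum X] {M : Type v} [MetricSpace M] {𝒜 : Set (Set X)}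
    {ℬ : Set (Set M)} (h𝒜 : TopologicalSpace.IsTopologicalBasis 𝒜)
    (hℬ : TopologicalSpace.IsTopologicalBasis ℬ) (c : PointedCover X x₀) {u : c.carrier → M}
    (hu : IsEmbedding u) :
    ∃ (k : Set (Set X × Set M) × ℕ), c.IsCode k ∧ k.1.Finite ∧ k.1 ⊆ 𝒜 ×ˢ ℬ := by
  obtain ⟨δ, hδ, hdist⟩ := c.exists_pos_lt_dist hu.continuous hu.injective
  obtain ⟨n, hn⟩ := exists_nat_one_div_lt hδ
  set ε : ℝ := 1 / ((n : ℝ) + 1)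
  have hε : 0 < ε := by positivity
  have : ∀ a : c.carrier, ∃ W : Set X × Set M, W ∈ 𝒜 ×ˢ ℬ ∧ c.proj a ∈ W.1 ∧ u a ∈ W.2 ∧
      (∀ x ∈ W.1, ∃ a, c.proj a = x ∧ u a ∈ W.2) ∧ ∀ v ∈ W.2, ∀ v' ∈ W.2, dist v v' < ε / 3 := by
    intro a
    -- Radius `ε / 6` makes the diameter bound `ε / 3` strict.
    obtain ⟨V, hV, haV, hVball⟩ := hℬ.mem_nhds_iff.1 (Metric.ball_mem_nhds (u a) (half_pos
      (div_pos hε three_pos)))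
    have h1 : c.proj '' (u ⁻¹' V) ∈ 𝓝 (c.proj a) :=
      (c.isCoveringMap_proj.isOpenMap _ ((hℬ.isOpen hV).preimage hu.continuous)).mem_nhds
        ⟨a, haV, rfl⟩
    obtain ⟨U, hU, haU, hUV⟩ := h𝒜.mem_nhds_iff.1 h1
    refine ⟨(U, V), ⟨hU, hV⟩, haU, haV, fun x hx => ?_, fun v hv v' hv' => ?_⟩
    · obtain ⟨b, hb, rfl⟩ := hUV hx
      exact ⟨b, rfl, hb⟩
    · have h2 := Metric.mem_ball.1 (hVball hv)
      have h3 := Metric.mem_ball.1 (hVball hv')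
      have h4 := dist_triangle_right v v' (u a)
      linarith
  choose W hW h1 h2 h3 h4 using this
  obtain ⟨t, ht⟩ := isCompact_univ.elim_finite_subcover
    (fun a => c.proj ⁻¹' (W a).1 ∩ u ⁻¹' (W a).2)
    (fun a => ((h𝒜.isOpen (hW a).1).preimage c.isCoveringMap_proj.continuous).inter
      ((hℬ.isOpen (hW a).2).preimage hu.continuous))
    fun a _ => mem_iUnion.2 ⟨a, h1 a, h2 a⟩
  refine ⟨(W '' t, n), ⟨u, hu.continuous, ?_, ?_, ?_, ?_⟩, t.finite_toSet.image W, ?_⟩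
  · intro a b hab hp
    obtain ⟨g, hg, rfl⟩ := (c.regular.fiber_eq_orbit a b).1 hp
    refine hn.trans (hdist ⟨g, hg⟩ (fun h => hab ?_) a)
    have := Subtype.ext_iff.1 h
    simp only at this
    rw [this]
    rfl
  · intro a
    obtain ⟨b, hb, h5⟩ := mem_iUnion₂.1 (ht (mem_univ a))
    exact ⟨W b, mem_image_of_mem W hb, h5⟩
  · rintro _ ⟨a, -, rfl⟩
    exact h3 a
  · rintro _ ⟨a, -, rfl⟩
    exact h4 a
  · rintro _ ⟨a, -, rfl⟩
    exact hW a

/-- Up to isomorphism there are only countably many covers of a continuum by continua. -/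
theorem exists_countable_dominating (X : Type u) [TopologicalSpace X] [IsContinuum X] (x₀ : X) :
    ∃ C : Set (PointedCover X x₀), C.Countable ∧ ∀ c, ∃ d ∈ C, ∃ h, d.IsBonding c h := by
  have := IsContinuum.secondCountableTopology X
  let _ : MetricSpace (ℕ → unitInterval) := TopologicalSpace.metrizableSpaceMetric _
  let 𝒜 := TopologicalSpace.countableBasis X
  let ℬ := TopologicalSpace.countableBasis (ℕ → unitInterval)
  let K : Set (Set (Set X × Set (ℕ → unitInterval)) × ℕ) :=
    {s | s.Finite ∧ s ⊆ 𝒜 ×ˢ ℬ} ×ˢ univ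
  have hK : K.Countable :=
    (countable_ofPred_finite_subset ((TopologicalSpace.countable_countableBasis X).prod
      (TopologicalSpace.countable_countableBasis _))).prod countable_univ
  classical
  -- One cover is kept per code; the trivial cover fills in for codes that no cover has.
  refine ⟨(fun k => if h : ∃ c : PointedCover X x₀, c.IsCode k then h.choose
    else trivialCover X x₀) '' K, hK.image _, fun c => ?_⟩
  let _ := TopologicalSpace.metrizableSpaceMetric c.carrier
  obtain ⟨u, hu⟩ := Metric.PiNatEmbed.exists_embedding_to_hilbert_cube (X := c.carrier)
  obtain ⟨k, hk, hfin, hsub⟩ := c.exists_isCode (TopologicalSpace.isBasis_countableBasis X)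
    (TopologicalSpace.isBasis_countableBasis _) hu
  have hex : ∃ c : PointedCover X x₀, c.IsCode k := ⟨c, hk⟩
  exact ⟨hex.choose, ⟨k, ⟨⟨hfin, hsub⟩, mem_univ _⟩, dif_pos hex⟩,
    hex.choose_spec.exists_isBonding hk⟩

end PointedCover

/-- The coordinates in a countable dominating family determine all others, so the compact limit
embeds in a countable product of metrizable spaces. -/
instance CompactUniversalCover.instIsContinuum {X : Type u} [TopologicalSpace X] [IsContinuum X]
    {x₀ : X} : IsContinuum (CompactUniversalCover X x₀) where
  toMetrizableSpace := by
    obtain ⟨C, hC, hdom⟩ := PointedCover.exists_countable_dominating X x₀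
    have := hC.to_subtype
    let φ : CompactUniversalCover X x₀ → ∀ c : C, c.1.carrier := fun x c => x.1 c
    have hφ : Continuous φ := continuous_pi fun c => continuous_coord c.1
    have hinj : Function.Injective φ := by
      intro x y hxy
      refine Subtype.ext (funext fun c => ?_)
      obtain ⟨d, hd, h, hh⟩ := hdom c
      rw [← x.2 d c h hh, ← y.2 d c h hh]
      exact congrArg h (congrFun hxy ⟨d, hd⟩)
    exact (hφ.isClosedEmbedding hinj).isEmbedding.metrizableSpace

/-! ### Generalized regular coverings by compactly simply connected continua -/

/-- The quotient of a compact Hausdorff space by a closed equivalence relation is Hausdorff. -/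
theorem Setoid.t2Space_quotient_of_isClosed {T : Type u} [TopologicalSpace T] [CompactSpace T]
    [T2Space T] (s : Setoid T) (hs : IsClosed {z : T × T | s z.1 z.2}) : T2Space (Quotient s) := by
  have hclosed : IsClosedMap (Quotient.mk s) := by
    intro C hC
    rw [← isQuotientMap_quotient_mk'.isClosed_preimage]
    have : Quotient.mk s ⁻¹' (Quotient.mk s '' C) =
        Prod.snd '' ({z : T × T | s z.1 z.2} ∩ Prod.fst ⁻¹' C) := by
      ext a
      constructor
      · rintro ⟨b, hb, hba⟩
        exact ⟨(b, a), ⟨Quotient.exact hba, hb⟩, rfl⟩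
      · rintro ⟨⟨b, a⟩, ⟨h1, h2⟩, rfl⟩
        exact ⟨b, h2, Quotient.sound h1⟩
    exact this ▸ isClosedMap_snd_of_compactSpace _ (hs.inter (hC.preimage continuous_fst))
  have hfiber : ∀ q : Quotient s, IsClosed (Quotient.mk s ⁻¹' {q}) := by
    intro q
    obtain ⟨a, rfl⟩ := Quotient.exists_rep q
    refine IsClosed.preimage continuous_quotient_mk' ?_
    rw [← image_singleton]
    exact hclosed _ isClosed_singleton
  refine ⟨fun x y hxy => ?_⟩
  obtain ⟨U, V, hU, hV, hxU, hyV, hd⟩ := normal_separation (hfiber x) (hfiber y)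
    (Disjoint.preimage _ (disjoint_singleton.2 hxy))
  refine ⟨(Quotient.mk s '' Uᶜ)ᶜ, (Quotient.mk s '' Vᶜ)ᶜ,
    (hclosed _ hU.isClosed_compl).isOpen_compl, (hclosed _ hV.isClosed_compl).isOpen_compl, ?_, ?_,
    ?_⟩
  · rintro ⟨a, ha, rfl⟩
    exact ha (hxU rfl)
  · rintro ⟨a, ha, rfl⟩
    exact ha (hyV rfl)
  · rw [disjoint_left]
    intro q hq hq'
    obtain ⟨a, rfl⟩ := Quotient.exists_rep q
    have h1 : a ∈ U := by
      by_contra h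
      exact hq ⟨a, h, rfl⟩
    have h2 : a ∈ V := by
      by_contra h
      exact hq' ⟨a, h, rfl⟩
    exact disjoint_left.1 hd h1 h2

/-- Maps from a compactly simply connected continuum lift to the covers by continua. -/
theorem CompactlySimplyConnected.exists_lift {X : Type u} [TopologicalSpace X] [IsContinuum X]
    {x₀ : X} {Y : Type v} [TopologicalSpace Y] (hY : CompactlySimplyConnected Y) {f : Y → X}
    (hf : Continuous f) {y₀ : Y} (hy₀ : f y₀ = x₀) (c : PointedCover X x₀) :
    ∃ l : Y → c.carrier, Continuous l ∧ (∀ y, c.proj (l y) = f y) ∧ l y₀ = c.base := by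
  have := hY.continuum
  -- A component of the pulled-back cover is a cover of `Y`, hence projects homeomorphically; the
  -- inverse is a section and yields the lift.
  let T : Set (Y × c.carrier) := {x | f x.1 = c.proj x.2}
  have hpc := c.isCoveringMap_proj.continuous
  have hclosed : IsClosed T := isClosed_eq (hf.comp continuous_fst) (hpc.comp continuous_snd)
  have : CompactSpace T := isCompact_iff_compactSpace.1 hclosed.isCompact
  have hT : IsFiniteFreeQuotient fun x : T => x.1.1 := by
    refine ⟨by fun_prop, ?_, ?_⟩
    · intro y
      obtain ⟨z, hz⟩ := c.surjective_proj (f y)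
      exact ⟨⟨(y, z), hz.symm⟩, rfl⟩
    · have := c.finite_deck
      refine ⟨range fun (g : c.deck) (x : T) => (⟨(x.1.1, (g : Equiv.Perm _) x.1.2), by
          change f _ = c.proj _
          rw [c.proj_apply_of_mem_deck g.2]
          exact x.2⟩ : T), finite_range _, ?_, ?_⟩
      · rintro _ ⟨g, rfl⟩
        refine ⟨?_, ?_, ?_⟩
        · have h1 := c.regular.continuous_of_mem _ g.2
          fun_prop
        · exact fun x => rfl
        · by_cases h : g = 1
          · left
            subst h
            rfl
          · right
            intro a ha
            have h2 := congrArg (fun x : T => x.1.2) ha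
            exact h (Subtype.ext (c.regular.free _ g.2 _ h2))
      · intro x y hxy
        obtain ⟨g, hg, h⟩ := (c.regular.fiber_eq_orbit x.1.2 y.1.2).1
          (x.2.symm.trans ((congrArg f hxy).trans y.2))
        exact ⟨_, ⟨⟨g, hg⟩, rfl⟩, Subtype.ext (Prod.ext hxy h)⟩
  obtain ⟨e, j, hj, hpj, hjb⟩ := hT.exists_pointedCover
    (t := ⟨(y₀, c.base), hy₀.trans c.proj_base.symm⟩) rfl
  have hbij : Function.Bijective e.proj := ⟨hY.injective_proj e, e.surjective_proj⟩
  let η : e.carrier ≃ₜ Y := e.isCoveringMap_proj.continuous.homeoOfEquivCompactToT2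
    (f := Equiv.ofBijective e.proj hbij)
  have hη : ∀ y, e.proj (η.symm y) = y := η.apply_symm_apply
  refine ⟨fun y => (j (η.symm y)).1.2, by fun_prop, fun y => ?_, ?_⟩
  · rw [← (j (η.symm y)).2]
    exact congrArg f ((hpj _).trans (hη y))
  · have : η.symm y₀ = e.base := hbij.1 ((hη y₀).trans e.proj_base.symm)
    simp only [this, hjb]

section Uniform

variable {X : Type u} [UniformSpace X] {Y : Type v} [UniformSpace Y] {f : Y → X}
  {G : Subgroup (Equiv.Perm Y)}

theorem ActsIsomorphically.continuous (hG : ActsIsomorphically G) {g : Equiv.Perm Y} (hg : g ∈ G) :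
    Continuous g := by
  refine UniformContinuous.continuous fun U hU => ?_
  obtain ⟨E, hE, hEU, -, hinv⟩ := hG U hU
  refine Filter.mem_map.2 (Filter.mem_of_superset hE fun z hz => hEU ?_)
  rw [← hinv g hg]
  exact ⟨z, hz, rfl⟩

theorem IsGeneralizedRegularCovering.continuous (hf : IsGeneralizedRegularCovering f G) :
    Continuous f := by
  refine UniformContinuous.continuous ?_
  rw [UniformContinuous, hf.uniformity_eq]
  exact Filter.tendsto_map

theorem IsGeneralizedRegularCovering.isOpenMap [CompactSpace Y] [T2Space X]
    (hf : IsGeneralizedRegularCovering f G) : IsOpenMap f := by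
  have hquot : IsQuotientMap f :=
    hf.continuous.isClosedMap.isQuotientMap hf.continuous hf.surjective
  intro U hU
  rw [← hquot.isOpen_preimage]
  have : f ⁻¹' (f '' U) = ⋃ g ∈ G, g ⁻¹' U := by
    ext a
    simp only [mem_preimage, mem_image, mem_iUnion, exists_prop]
    constructor
    · rintro ⟨b, hb, hba⟩
      obtain ⟨g, hg, rfl⟩ := (hf.fiber_eq_orbit a b).1 hba.symm
      exact ⟨g, hg, hb⟩
    · rintro ⟨g, hg, h⟩
      exact ⟨g a, h, ((hf.fiber_eq_orbit a (g a)).2 ⟨g, hg, rfl⟩).symm⟩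
  rw [this]
  exact isOpen_biUnion fun g hg => hU.preimage (hf.isomorphic.continuous hg)

/-- A generalized regular covering map of a compact space factors through finite free quotients
with small fibers. -/
theorem IsGeneralizedRegularCovering.exists_isFiniteFreeQuotient [CompactSpace Y] [T2Space Y]
    [T2Space X] [Nonempty Y]
    (hf : IsGeneralizedRegularCovering f G) {E : Set (Y × Y)} (hE : E ∈ 𝓤 Y) :
    ∃ (s : Setoid Y) (p : Quotient s → X), T2Space (Quotient s) ∧ IsFiniteFreeQuotient p ∧
      (∀ y, p (Quotient.mk s y) = f y) ∧ ∀ y z, s y z → (y, z) ∈ E := by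
  obtain ⟨F₀, hF₀, hsmall⟩ := hf.prodiscrete E hE
  obtain ⟨F, hF, hFF₀, hsymm, hinv⟩ := hf.isomorphic F₀ hF₀
  let N := smallMoveSubgroup G F
  have hNG : N ≤ G := (Subgroup.closure_le G).2 fun g hg => hg.1
  have hN : ∀ g ∈ G, ∀ x, (x, g x) ∈ F → g ∈ N := fun g hg x hx =>
    Subgroup.subset_closure ⟨hg, x, hx⟩
  have hNE : ∀ n ∈ N, ∀ x, (x, n x) ∈ E := fun n hn x =>
    hsmall n (Subgroup.closure_mono (show {g : Equiv.Perm Y | g ∈ G ∧ ∃ x, (x, g x) ∈ F} ⊆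
      {g | g ∈ G ∧ ∃ x, (x, g x) ∈ F₀} from
      fun g hg => ⟨hg.1, hg.2.imp fun x hx => hFF₀ hx⟩) hn) x
  -- Invariance of `F`: if `n` moves `x` within `F`, the conjugate moves `g x` within `F`.
  have hconj : ∀ g ∈ G, ∀ n ∈ N, g * n * g⁻¹ ∈ N := by
    intro g hg n hn
    induction hn using Subgroup.closure_induction with
    | mem n hn =>
      obtain ⟨hn, x, hx⟩ := hn
      refine hN _ (G.mul_mem (G.mul_mem hg hn) (G.inv_mem hg)) (g x) ?_
      rw [← hinv g hg]
      exact ⟨_, hx, by simp⟩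
    | one => simp [N.one_mem]
    | mul a b _ _ ha hb =>
      have := N.mul_mem ha hb
      simpa [mul_assoc] using this
    | inv a _ ha =>
      have := N.inv_mem ha
      simpa [mul_assoc] using this
  let s : Setoid Y :=
    { r := fun y z => ∃ n ∈ N, n y = z
      iseqv :=
        { refl := fun y => ⟨1, N.one_mem, rfl⟩
          symm := by
            rintro y z ⟨n, hn, rfl⟩
            exact ⟨n⁻¹, N.inv_mem hn, by simp⟩
          trans := by
            rintro y z w ⟨n, hn, rfl⟩ ⟨m, hm, rfl⟩
            exact ⟨m * n, N.mul_mem hm hn, rfl⟩ } }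
  have hfs : ∀ y z, s y z → f y = f z := by
    rintro y z ⟨n, hn, rfl⟩
    exact (hf.fiber_eq_orbit _ _).2 ⟨n, hNG hn, rfl⟩
  -- Suppose `z = g y` is not in the `N`-orbit of `y`. For a nearby pair `(y', n y')` the points `n
  -- y'` and `g y'` would be `F`-close, forcing `g * n⁻¹`, hence `g`, into `N`.
  have hclosed : IsClosed {z : Y × Y | s z.1 z.2} := by
    rw [← isOpen_compl_iff, isOpen_iff_mem_nhds]
    rintro ⟨y, z⟩ hyz
    by_cases hfyz : f y = f z
    · obtain ⟨g, hg, rfl⟩ := (hf.fiber_eq_orbit y z).1 hfyz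
      have hc : Continuous fun w : Y × Y => (w.2, g w.1) :=
        continuous_snd.prodMk ((hf.isomorphic.continuous hg).comp continuous_fst)
      have h1 : {w : Y × Y | (w.2, g w.1) ∈ F} ∈ 𝓝 (y, g y) :=
        hc.continuousAt (nhds_le_uniformity (g y) hF)
      refine Filter.mem_of_superset h1 ?_
      rintro ⟨y', z'⟩ hF' ⟨n, hn, hnz⟩
      change n y' = z' at hnz
      change (z', g y') ∈ F at hF'
      subst hnz
      have h2 : g * n⁻¹ ∈ N := hN _ (G.mul_mem hg (G.inv_mem (hNG hn))) (n y') (by simpa using hF')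
      have h3 : g ∈ N := by simpa using N.mul_mem h2 hn
      exact hyz ⟨g, h3, rfl⟩
    · have h1 : IsOpen {w : Y × Y | f w.1 ≠ f w.2} :=
        isOpen_ne_fun (hf.continuous.comp continuous_fst) (hf.continuous.comp continuous_snd)
      exact Filter.mem_of_superset (h1.mem_nhds hfyz) fun w hw hs => hw (hfs _ _ hs)
  let φ : G → Quotient s → Quotient s := fun g => Quotient.map (g : Equiv.Perm Y) (by
    rintro y z ⟨n, hn, rfl⟩
    exact ⟨_, hconj g g.2 n hn, by simp⟩)
  have hφ : ∀ g g' : G, ∀ y : Y, ((g : Equiv.Perm Y) y, (g' : Equiv.Perm Y) y) ∈ F →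
      φ g = φ g' := by
    intro g g' y hy
    ext q
    obtain ⟨z, rfl⟩ := Quotient.exists_rep q
    refine Quotient.sound ⟨(g' * g⁻¹ : Equiv.Perm Y), hN _ (G.mul_mem g'.2 (G.inv_mem g.2))
      ((g : Equiv.Perm Y) y) (by simpa using hy), by simp⟩
  have hφone : φ 1 = id := by
    ext q
    obtain ⟨z, rfl⟩ := Quotient.exists_rep q
    rfl
  refine ⟨s, Quotient.lift f hfs, s.t2Space_quotient_of_isClosed hclosed, ⟨?_, ?_, ?_⟩,
    fun y => rfl, ?_⟩
  · exact hf.continuous.quotient_lift hfs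
  · intro x
    obtain ⟨y, rfl⟩ := hf.surjective x
    exact ⟨Quotient.mk s y, rfl⟩
  · refine ⟨range φ, ?_, ?_, ?_⟩
    -- The induced map `φ g` depends only on `g y` up to `F`, and total boundedness leaves finitely
    -- many possibilities.
    · obtain ⟨D, hD, hDsymm, hDF⟩ := comp_symm_mem_uniformity_sets hF
      obtain ⟨t, ht, htc⟩ := isCompact_univ.totallyBounded D hD
      obtain ⟨y⟩ := ‹Nonempty Y›
      have : ∀ g : G, ∃ r ∈ t, ((g : Equiv.Perm Y) y, r) ∈ D := by
        intro g
        simpa using htc (mem_univ ((g : Equiv.Perm Y) y))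
      choose r hrt hrD using this
      have := ht.to_subtype
      have hfac : ∀ g g', r g = r g' → φ g = φ g' := by
        intro g g' h
        refine hφ g g' y (hDF ?_)
        exact ⟨r g, hrD g, SetRel.symm D (h ▸ hrD g')⟩
      have h1 : Finite (range φ) := by
        refine Finite.of_injective (fun q : range φ => (⟨r q.2.choose, hrt _⟩ : t)) ?_
        intro q q' h
        have h2 := hfac _ _ (Subtype.ext_iff.1 h)
        rw [q.2.choose_spec, q'.2.choose_spec] at h2
        exact Subtype.ext h2
      exact h1
    · rintro _ ⟨g, rfl⟩
      refine ⟨?_, ?_, ?_⟩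
      · exact Continuous.quotient_map' (hf.isomorphic.continuous g.2) _
      · intro q
        obtain ⟨z, rfl⟩ := Quotient.exists_rep q
        exact ((hf.fiber_eq_orbit _ _).2 ⟨g, g.2, rfl⟩).symm
      -- Fixing one `N`-orbit means that `n * g` fixes a point for some `n ∈ N`; as `F` is
      -- reflexive, this puts `g` in `N`.
      · by_cases h : ∃ a, φ g a = a
        · left
          obtain ⟨a, ha⟩ := h
          obtain ⟨z, rfl⟩ := Quotient.exists_rep a
          obtain ⟨n, hn, hnz⟩ := Quotient.exact ha
          have h1 : n * g ∈ N := hN _ (G.mul_mem (hNG hn) g.2) z (by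
            rw [Equiv.Perm.mul_apply, hnz]
            exact refl_mem_uniformity hF)
          have h2 : (g : Equiv.Perm Y) ∈ N := by simpa using N.mul_mem (N.inv_mem hn) h1
          ext q
          obtain ⟨w, rfl⟩ := Quotient.exists_rep q
          exact Quotient.sound ⟨(g : Equiv.Perm Y)⁻¹, N.inv_mem h2, by simp⟩
        · exact Or.inr fun a ha => h ⟨a, ha⟩
    · intro a b hab
      obtain ⟨y, rfl⟩ := Quotient.exists_rep a
      obtain ⟨z, rfl⟩ := Quotient.exists_rep b
      obtain ⟨g, hg, rfl⟩ := (hf.fiber_eq_orbit y z).1 hab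
      exact ⟨_, ⟨⟨g, hg⟩, rfl⟩, rfl⟩
  · rintro y z ⟨n, hn, rfl⟩
    exact hNE n hn y

/-- A generalized regular covering map by a compactly simply connected continuum is equivalent to
the compact universal cover. -/
theorem IsGeneralizedRegularCovering.exists_homeomorph [IsContinuum X] (x₀ : X)
    (hY : CompactlySimplyConnected Y) (hf : IsGeneralizedRegularCovering f G) :
    ∃ (h : Y ≃ₜ CompactUniversalCover X x₀) (θ : G ≃* ProfiniteFundamentalGroup X x₀),
      (∀ (g : G) (y : Y), h ((g : Equiv.Perm Y) y) = θ g • h y) ∧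
      ∀ y : Y, CompactUniversalCover.proj X x₀ (h y) = f y := by
  have := hY.continuum
  obtain ⟨y₀, hy₀⟩ := hf.surjective x₀
  have : Nonempty Y := ⟨y₀⟩
  choose l hl hlp hlb using hY.exists_lift hf.continuous hy₀
  let k : Y → CompactUniversalCover X x₀ := fun y => ⟨fun c => l c y, fun c d h hh =>
    d.lift_unique (hh.continuous.comp (hl c)) (hl d)
      (fun a => (hh.proj_comp _).trans ((hlp c a).trans (hlp d a).symm)) (a := y₀)
      (by simp [hlb, hh.map_base]) y⟩
  have hk : Continuous k := Continuous.subtype_mk (continuous_pi hl) _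
  have hkp : ∀ y, CompactUniversalCover.proj X x₀ (k y) = f y := fun y =>
    hlp (PointedCover.trivialCover X x₀) y
  have hθ : ∀ g : G, ∃ γ : ProfiniteFundamentalGroup X x₀, ∀ y,
      k ((g : Equiv.Perm Y) y) = γ • k y := by
    intro g
    have hfg : ∀ y, f ((g : Equiv.Perm Y) y) = f y := fun y =>
      ((hf.fiber_eq_orbit _ _).2 ⟨g, g.2, rfl⟩).symm
    obtain ⟨γ, hγ⟩ := CompactUniversalCover.exists_smul_eq (x := k y₀)
      (y := k ((g : Equiv.Perm Y) y₀)) (by rw [hkp, hkp, hfg])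
    refine ⟨γ, fun y => Subtype.ext (funext fun c => ?_)⟩
    refine c.lift_unique (k := fun y => l c ((g : Equiv.Perm Y) y))
      (l := fun y => (γ.1 c : Equiv.Perm c.carrier) (l c y)) (a := y₀)
      ((hl c).comp (hf.isomorphic.continuous g.2))
      ((c.regular.continuous_of_mem _ (γ.1 c).2).comp (hl c)) (fun y => ?_) ?_ y
    · rw [c.proj_apply_of_mem_deck (γ.1 c).2, hlp, hlp, hfg]
    · exact (congrFun (Subtype.ext_iff.1 hγ) c).symm
  choose θ hθ using hθ
  have hinj : Function.Injective k := by
    intro y z hyz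
    refine eq_of_uniformity fun {E} hE => ?_
    obtain ⟨s, p, hT2, hp, hpf, hs⟩ := hf.exists_isFiniteFreeQuotient hE
    obtain ⟨c, j, hj, hpj, hjb⟩ := hp.exists_pointedCover (t := Quotient.mk s y₀)
      ((hpf y₀).trans hy₀)
    -- The class of `y` in the small-fibred quotient is read off from the single coordinate `c` of
    -- `k y`.
    have hlift : ∀ y, j (l c y) = Quotient.mk s y := congrFun
      (hp.isCoveringMap.eq_of_comp_eq (hj.comp (hl c)) continuous_quotient_mk'
      (funext fun y => (hpj _).trans ((hlp c y).trans (hpf y).symm)) y₀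
      ((congrArg j (hlb c)).trans hjb))
    refine hs y z (Quotient.exact ?_)
    rw [← hlift, ← hlift]
    exact congrArg j (congrFun (Subtype.ext_iff.1 hyz) c)
  have hsurj : Function.Surjective k := by
    intro x
    by_contra hx
    obtain ⟨c, hc⟩ := CompactUniversalCover.exists_forall_coord_eq_mem
      (isClosed_singleton.prod (isCompact_range hk).isClosed : IsClosed ({x} ×ˢ range k)).isOpen_compl
      (fun a ha => hx ((mem_singleton_iff.1 ha.1) ▸ ha.2))
    have hopen : IsOpenMap fun y => c.proj (l c y) := by
      simp only [hlp]
      exact hf.isOpenMap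
    obtain ⟨y, hy⟩ := c.surjective_of_isOpenMap_proj_comp (hl c) hopen (x.1 c)
    exact hc x (k y) hy.symm ⟨rfl, y, rfl⟩
  let η : Y ≃ₜ CompactUniversalCover X x₀ := hk.homeoOfEquivCompactToT2
    (f := Equiv.ofBijective k ⟨hinj, hsurj⟩)
  let Θ : G →* ProfiniteFundamentalGroup X x₀ := MonoidHom.mk' θ fun g g' =>
    CompactUniversalCover.smul_right_injective (x := k y₀) (by
      rw [← hθ, mul_smul, ← hθ, ← hθ]
      rfl)
  refine ⟨η, MulEquiv.ofBijective Θ ⟨?_, ?_⟩, fun g y => hθ g y, hkp⟩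
  · intro g g' hgg'
    ext y
    refine hinj ?_
    rw [hθ, hθ]
    exact congrArg (· • k y) hgg'
  · intro γ
    obtain ⟨y, hy⟩ := hsurj (γ • k y₀)
    obtain ⟨g, hg, rfl⟩ := (hf.fiber_eq_orbit y₀ y).1 (by
      rw [← hkp, ← hkp, hy, CompactUniversalCover.proj_smul])
    refine ⟨⟨g, hg⟩, CompactUniversalCover.smul_right_injective (x := k y₀) ?_⟩
    rw [← hy]
    exact (hθ ⟨g, hg⟩ y₀).symm

end Uniform

/-! ### Simple connectivity of the compact universal cover -/

/-- Local injectivity makes the diagonal open in the fibre product. This keeps the space of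
injective enumerations of fibres compact. -/
theorem IsLocallyInjective.isClosed_setOf_ne {V : Type u} {X : Type v} [TopologicalSpace V]
    [TopologicalSpace X] [T2Space X] {r : V → X} (hr : IsLocallyInjective r) (hc : Continuous r) :
    IsClosed {z : V × V | r z.1 = r z.2 ∧ z.1 ≠ z.2} := by
  rw [← isOpen_compl_iff, isOpen_iff_mem_nhds]
  rintro ⟨a, b⟩ hab
  by_cases h : r a = r b
  · have h1 : a = b := by
      by_contra hne
      exact hab ⟨h, hne⟩
    subst h1
    obtain ⟨U, hU, haU, hinj⟩ := hr a
    refine Filter.mem_of_superset ((hU.prod hU).mem_nhds ⟨haU, haU⟩) ?_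
    rintro ⟨x, y⟩ ⟨hx, hy⟩ ⟨h2, h3⟩
    exact h3 (hinj hx hy h2)
  · have h1 : IsOpen {z : V × V | r z.1 ≠ r z.2} :=
      isOpen_ne_fun (hc.comp continuous_fst) (hc.comp continuous_snd)
    exact Filter.mem_of_superset (h1.mem_nhds h) fun z hz hz' => hz hz'.1

/-- A finite cover of a continuum whose fibers all have the same cardinality is dominated by a
regular cover by a continuum. -/
theorem IsLocalHomeomorph.exists_pointedCover {X : Type u} [TopologicalSpace X] [IsContinuum X]
    {V : Type v} [TopologicalSpace V] [CompactSpace V] [T2Space V] {r : V → X}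
    (hr : IsLocalHomeomorph r) {F : Type w} [Finite F] (hF : ∀ x, Nonempty (F ≃ r ⁻¹' {x}))
    {v₀ : V} {x₀ : X} (hv₀ : r v₀ = x₀) :
    ∃ (c : PointedCover X x₀) (k : c.carrier → V), Continuous k ∧ (∀ a, r (k a) = c.proj a) ∧
      k c.base = v₀ := by
  have hrc := hr.continuous
  -- Enumerations of the fibres of `r`: permutations of `F` act freely and transitively on those
  -- over one point, so regularity is gained, and evaluation at `i₀` maps back to `V`.
  let T : Set (F → V) := {t | ∀ i j, r (t i) = r (t j) ∧ (i ≠ j → t i ≠ t j)}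
  have hclosed : IsClosed T := by
    simp only [T, ofPred_forall]
    refine isClosed_iInter fun i => isClosed_iInter fun j => ?_
    by_cases hij : i = j
    · simp [hij]
    · simp only [ne_eq, hij, not_false_eq_true, forall_const]
      have hij' : Continuous fun t : F → V => (t i, t j) := by fun_prop
      exact (hr.isLocallyInjective.isClosed_setOf_ne hrc).preimage hij'
  have : CompactSpace T := isCompact_iff_compactSpace.1 hclosed.isCompact
  have hTinj : ∀ t : T, Function.Injective t.1 := by
    intro t i j hij
    by_contra hne
    exact (t.2 i j).2 hne hij
  have hmk : ∀ (x : X) (e : F ≃ r ⁻¹' {x}), (fun i => (e i : V)) ∈ T := by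
    intro x e i j
    refine ⟨(e i).2.trans (e j).2.symm, fun hij h => hij (e.injective (Subtype.ext h))⟩
  obtain ⟨e₀⟩ := hF x₀
  let i₀ : F := e₀.symm ⟨v₀, hv₀⟩
  have hTsurj : ∀ (t : T) (v : V), r v = r (t.1 i₀) → ∃ i, t.1 i = v := by
    intro t v hv
    obtain ⟨e⟩ := hF (r (t.1 i₀))
    let m : F → F := fun i => e.symm ⟨t.1 i, (t.2 i i₀).1⟩
    have hm : Function.Injective m := by
      intro i j hij
      exact hTinj t (Subtype.ext_iff.1 (e.symm.injective hij))
    obtain ⟨i, hi⟩ := Finite.injective_iff_surjective.1 hm (e.symm ⟨v, hv⟩)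
    exact ⟨i, Subtype.ext_iff.1 (e.symm.injective hi)⟩
  have hT : IsFiniteFreeQuotient fun t : T => r (t.1 i₀) := by
    refine ⟨hrc.comp ((continuous_apply i₀).comp continuous_subtype_val), ?_, ?_⟩
    · intro x
      obtain ⟨e⟩ := hF x
      exact ⟨⟨_, hmk x e⟩, (e i₀).2⟩
    · refine ⟨range fun (σ : Equiv.Perm F) (t : T) => (⟨fun i => t.1 (σ i), fun i j =>
        ⟨(t.2 _ _).1, fun hij => (t.2 _ _).2 (σ.injective.ne hij)⟩⟩ : T), finite_range _, ?_, ?_⟩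
      · rintro _ ⟨σ, rfl⟩
        refine ⟨?_, fun t => (t.2 _ _).1, ?_⟩
        · refine Continuous.subtype_mk (continuous_pi fun i => ?_) _
          exact (continuous_apply (A := fun _ : F => V) (σ i)).comp continuous_subtype_val
        · by_cases h : σ = 1
          · left
            subst h
            rfl
          · right
            intro t ht
            refine h (Equiv.ext fun i => hTinj t ?_)
            exact congrFun (Subtype.ext_iff.1 ht) i
      · intro t t' htt'
        have : ∀ i, ∃ j, t.1 j = t'.1 i := fun i =>
          hTsurj t _ (((t'.2 i i₀).1).trans htt'.symm)
        choose σ hσ using this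
        have hσi : Function.Injective σ := by
          intro i j hij
          refine hTinj t' ?_
          rw [← hσ, ← hσ, hij]
        refine ⟨_, ⟨Equiv.ofBijective σ ⟨hσi, Finite.injective_iff_surjective.1 hσi⟩, rfl⟩, ?_⟩
        exact Subtype.ext (funext hσ)
  have hi₀ : (e₀ i₀ : V) = v₀ := by simp [i₀]
  obtain ⟨c, j, hj, hpj, hjb⟩ := hT.exists_pointedCover (t := ⟨_, hmk x₀ e₀⟩) (b := x₀) (by
    simp only [hi₀, hv₀])
  refine ⟨c, fun a => (j a).1 i₀, ?_, hpj, ?_⟩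
  · exact (continuous_apply i₀).comp (continuous_subtype_val.comp hj)
  · simp only [hjb, hi₀]

/-- The covers of the compact universal cover are trivial. -/
theorem CompactUniversalCover.eq_one_of_mem_deck {X : Type u} [TopologicalSpace X] [IsContinuum X]
    {x₀ : X} {z₀ : CompactUniversalCover X x₀} (b : PointedCover (CompactUniversalCover X x₀) z₀)
    (g₀ : b.deck) : g₀ = 1 := by
  let _ := TopologicalSpace.metrizableSpaceMetric b.carrier
  have hfin := b.finite_deck
  obtain ⟨ε, hε, hmove⟩ := b.exists_pos_lt_dist (u := (id : b.carrier → b.carrier)) continuous_id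
    Function.injective_id
  have hcont : ∀ g : b.deck, Continuous (g : Equiv.Perm b.carrier) := fun g =>
    b.regular.continuous_of_mem g g.2
  -- Quantifying over the deck group makes nearness invariant. With bound `ε / 3`, a chain of three
  -- near steps cannot join `a` to `g a` unless `g = 1`.
  let Near : b.carrier → b.carrier → Prop := fun a a' =>
    ∀ g : b.deck, dist ((g : Equiv.Perm b.carrier) a) ((g : Equiv.Perm b.carrier) a') ≤ ε / 3
  have hnear_refl : ∀ a, Near a a := fun a g => by
    rw [dist_self]
    positivity
  have hnear_symm : ∀ a a', Near a a' → Near a' a := fun a a' h g => by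
    rw [dist_comm]
    exact h g
  have hnear_smul : ∀ (g : b.deck) a a', Near a a' →
      Near ((g : Equiv.Perm b.carrier) a) ((g : Equiv.Perm b.carrier) a') :=
    fun g a a' h g' => h (g' * g)
  have hnear_eq : ∀ (g : b.deck) a a' a'', Near a a' → Near a' a'' →
      Near a'' ((g : Equiv.Perm b.carrier) a) → g = 1 := by
    intro g a a' a'' h1 h2 h3
    by_contra hg
    have h4 : ε < dist a ((g : Equiv.Perm b.carrier) a) := hmove g hg a
    have h5 : dist a a' ≤ ε / 3 := h1 1
    have h6 : dist a' a'' ≤ ε / 3 := h2 1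
    have h7 : dist a'' ((g : Equiv.Perm b.carrier) a) ≤ ε / 3 := h3 1
    have h8 := dist_triangle4 a a' a'' ((g : Equiv.Perm b.carrier) a)
    linarith
  have hnear_closed : IsClosed {z : b.carrier × b.carrier | Near z.1 z.2} := by
    simp only [Near, ofPred_forall]
    exact isClosed_iInter fun g => isClosed_le (((hcont g).comp continuous_fst).dist
      ((hcont g).comp continuous_snd)) continuous_const
  let O : Set (b.carrier × b.carrier) := {z | ∀ g : b.deck,
    dist ((g : Equiv.Perm b.carrier) z.1) ((g : Equiv.Perm b.carrier) z.2) < ε / 3}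
  have hO : IsOpen O := by
    simp only [O, ofPred_forall]
    exact isOpen_iInter_of_finite fun g => isOpen_lt (((hcont g).comp continuous_fst).dist
      ((hcont g).comp continuous_snd)) continuous_const
  have hπ := b.isCoveringMap_proj
  -- The image of `O` is an open neighbourhood of the diagonal of the limit, so for some `c` any two
  -- points with equal `c`-coordinate have near lifts.
  obtain ⟨c, hc⟩ := exists_forall_coord_eq_mem ((hπ.isOpenMap.prodMap hπ.isOpenMap) O hO) (by
    intro x
    obtain ⟨a, rfl⟩ := b.surjective_proj x
    refine ⟨(a, a), fun g => ?_, rfl⟩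
    rw [dist_self]
    positivity)
  have hnear_exists : ∀ a a', (b.proj a).1 c = (b.proj a').1 c →
      ∃ g : b.deck, Near ((g : Equiv.Perm b.carrier) a) a' := by
    intro a a' h
    obtain ⟨⟨v, v'⟩, hv, hvv'⟩ := hc _ _ h
    obtain ⟨h1, h2⟩ := Prod.ext_iff.1 hvv'
    obtain ⟨g, hg, rfl⟩ := (b.regular.fiber_eq_orbit a v).1 h1.symm
    obtain ⟨g', hg', rfl⟩ := (b.regular.fiber_eq_orbit a' v').1 h2.symm
    have h3 := hnear_smul (⟨g', hg'⟩⁻¹ : b.deck) _ _ (fun k => (hv k).le)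
    exact ⟨⟨g', hg'⟩⁻¹ * ⟨g, hg⟩, by simpa using h3⟩
  -- Collapsing near points over the same point of `c` descends `b` to a finite cover of `c.carrier`
  -- on which `b.deck` still acts freely.
  let s : Setoid b.carrier :=
    { r := fun a a' => (b.proj a).1 c = (b.proj a').1 c ∧ Near a a'
      iseqv :=
        { refl := fun a => ⟨rfl, hnear_refl a⟩
          symm := fun h => ⟨h.1.symm, hnear_symm _ _ h.2⟩
          trans := by
            intro x y z hxy hyz
            refine ⟨hxy.1.trans hyz.1, ?_⟩
            obtain ⟨g, hg⟩ := hnear_exists x z (hxy.1.trans hyz.1)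
            have := hnear_eq g x y z hxy.2 hyz.2 (hnear_symm _ _ hg)
            subst this
            exact hg } }
  have hcoord : Continuous fun a => (b.proj a).1 c := (continuous_coord c).comp hπ.continuous
  have hT2 : T2Space (Quotient s) := s.t2Space_quotient_of_isClosed
    ((isClosed_eq (hcoord.comp continuous_fst) (hcoord.comp continuous_snd)).inter hnear_closed)
  let q : Quotient s → c.carrier := Quotient.lift (fun a => (b.proj a).1 c) fun a a' h => h.1
  have hqc : Continuous q := hcoord.quotient_lift _
  let φ : b.deck → Quotient s → Quotient s := fun g => Quotient.map (g : Equiv.Perm b.carrier) (by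
    rintro a a' ⟨h1, h2⟩
    refine ⟨?_, hnear_smul g _ _ h2⟩
    rw [b.proj_apply_of_mem_deck g.2, b.proj_apply_of_mem_deck g.2, h1])
  have hqφ : ∀ g v, q (φ g v) = q v := by
    intro g v
    obtain ⟨a, rfl⟩ := Quotient.exists_rep v
    exact congrArg (fun x => x.1 c) (b.proj_apply_of_mem_deck g.2 a)
  have hφ_eq : ∀ g g' v, φ g v = φ g' v → g = g' := by
    intro g g' v h
    obtain ⟨a, rfl⟩ := Quotient.exists_rep v
    have h1 := hnear_smul g⁻¹ _ _ (Quotient.exact h).2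
    have h2 := hnear_eq (g⁻¹ * g') a a a (hnear_refl a) (hnear_refl a) (by simpa using h1)
    exact inv_mul_eq_one.1 h2
  have hφone : φ 1 = id := by
    ext v
    obtain ⟨a, rfl⟩ := Quotient.exists_rep v
    rfl
  have hφ_fiber : ∀ v v', q v = q v' → ∃ g, φ g v = v' := by
    intro v v' h
    obtain ⟨a, rfl⟩ := Quotient.exists_rep v
    obtain ⟨a', rfl⟩ := Quotient.exists_rep v'
    obtain ⟨g, hg⟩ := hnear_exists a a' h
    refine ⟨g, Quotient.sound ⟨?_, hg⟩⟩
    rw [b.proj_apply_of_mem_deck g.2]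
    exact h
  have hqs : Function.Surjective q := by
    intro z
    obtain ⟨x, rfl⟩ := exists_coord_eq c z
    obtain ⟨a, rfl⟩ := b.surjective_proj x
    exact ⟨Quotient.mk s a, rfl⟩
  have hq : IsFiniteFreeQuotient q := by
    refine ⟨hqc, hqs, range φ, finite_range φ, ?_, ?_⟩
    · rintro _ ⟨g, rfl⟩
      refine ⟨Continuous.quotient_map' (hcont g) _, hqφ g, ?_⟩
      by_cases h : g = 1
      · exact Or.inl (h ▸ hφone)
      · refine Or.inr fun v hv => h (hφ_eq g 1 v ?_)
        rw [hv, hφone]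
        rfl
    · intro v v' h
      obtain ⟨g, hg⟩ := hφ_fiber v v' h
      exact ⟨_, ⟨g, rfl⟩, hg⟩
  have hr : IsLocalHomeomorph (c.proj ∘ q) :=
    c.isCoveringMap_proj.isLocalHomeomorph.comp hq.isLocalHomeomorph
  have hfinc := c.finite_deck
  have hF : ∀ x, Nonempty (c.deck × b.deck ≃ (c.proj ∘ q) ⁻¹' {x}) := by
    intro x
    obtain ⟨z, rfl⟩ := c.surjective_proj x
    choose σ hσ using hqs
    let m : c.deck × b.deck → (c.proj ∘ q) ⁻¹' {c.proj z} := fun g =>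
      ⟨φ g.2 (σ ((g.1 : Equiv.Perm c.carrier) z)), by
        simp only [mem_preimage, Function.comp, mem_singleton_iff, hqφ, hσ,
          c.proj_apply_of_mem_deck g.1.2]⟩
    refine ⟨Equiv.ofBijective m ⟨?_, ?_⟩⟩
    · rintro ⟨g, k⟩ ⟨g', k'⟩ h
      have h1 : φ k (σ ((g : Equiv.Perm c.carrier) z)) = φ k' (σ ((g' : Equiv.Perm c.carrier) z)) :=
        Subtype.ext_iff.1 h
      have h2 := congrArg q h1
      rw [hqφ, hqφ, hσ, hσ] at h2
      obtain rfl := c.deck_ext h2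
      rw [hφ_eq _ _ _ h1]
    · rintro ⟨v, hv⟩
      obtain ⟨g, hg, hgz⟩ := (c.regular.fiber_eq_orbit z (q v)).1 (Eq.symm hv)
      obtain ⟨k, hk⟩ := hφ_fiber (σ (g z)) v (by rw [hσ, hgz])
      exact ⟨(⟨g, hg⟩, k), Subtype.ext hk⟩
  let y₀ : CompactUniversalCover X x₀ := ⟨fun c => c.base, fun _ _ _ hh => hh.map_base⟩
  obtain ⟨a₀, ha₀⟩ := b.surjective_proj y₀
  have hqa₀ : q (Quotient.mk s a₀) = c.base := congrArg (fun x => x.1 c) ha₀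
  obtain ⟨d, k, hk, hkp, hkb⟩ := hr.exists_pointedCover hF (v₀ := Quotient.mk s a₀) (x₀ := x₀)
    ((congrArg c.proj hqa₀).trans c.proj_base)
  have hbond : d.IsBonding c (q ∘ k) := PointedCover.isBonding_of_continuous (hqc.comp hk) hkp
    ((congrArg q hkb).trans hqa₀)
  -- Both sides lift the `c`-coordinate through `q` and agree at `a₀`. Thus the class of `a` depends
  -- only on `b.proj a`, which `g₀` preserves.
  have hfactor : ∀ a, Quotient.mk s a = k ((b.proj a).1 d) := by
    refine congrFun (hq.isCoveringMap.eq_of_comp_eq continuous_quotient_mk'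
      (hk.comp ((continuous_coord d).comp hπ.continuous)) (funext fun a => ?_) a₀ ?_)
    · exact ((b.proj a).2 d c _ hbond).symm
    · rw [ha₀]
      exact hkb.symm
  refine hφ_eq g₀ 1 (Quotient.mk s b.base) ?_
  rw [hφone]
  change Quotient.mk s ((g₀ : Equiv.Perm b.carrier) b.base) = Quotient.mk s b.base
  rw [hfactor, hfactor, b.proj_apply_of_mem_deck g₀.2]

theorem CompactUniversalCover.compactlySimplyConnected {X : Type u} [TopologicalSpace X]
    [IsContinuum X] (x₀ : X) : CompactlySimplyConnected (CompactUniversalCover X x₀) where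
  continuum := inferInstance
  trivial_group := fun _ => ⟨fun γ δ => Subtype.ext (funext fun b =>
    (eq_one_of_mem_deck b (γ.1 b)).trans (eq_one_of_mem_deck b (δ.1 b)).symm)⟩

/-- The compact universal cover of a continuum `X` is a compactly simply connected continuum, and
every generalized regular covering map `f : Y → X = Y / G` by a compactly simply connected
continuum `Y` is equivalent to it: there are a homeomorphism `h` (a uniform homeomorphism, since
both spaces are compact Hausdorff) over `X` and an isomorphism `θ` of the deck groups that are
compatible with the actions. -/
theorem theorem4 (X : Type u) [UniformSpace X] [IsContinuum X] (x₀ : X) :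
    CompactlySimplyConnected (CompactUniversalCover X x₀) ∧
    ∀ (Y : Type v) [UniformSpace Y] (f : Y → X) (G : Subgroup (Equiv.Perm Y)),
      CompactlySimplyConnected Y → IsGeneralizedRegularCovering f G →
      ∃ (h : Y ≃ₜ CompactUniversalCover X x₀) (θ : G ≃* ProfiniteFundamentalGroup X x₀),
        (∀ (g : G) (y : Y), h ((g : Equiv.Perm Y) y) = θ g • h y) ∧
        ∀ y : Y, CompactUniversalCover.proj X x₀ (h y) = f y :=
  ⟨CompactUniversalCover.compactlySimplyConnected x₀,
    fun _ _ _ _ hY hf => hf.exists_homeomorph x₀ hY⟩
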